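/- Let $n,p,k,m\ge 1$ be integers with $k\le p$. For a dictionary $D=(d_1,\dots,d_p)$ of vectors in $\mathbb{R}^n$ let $$h_{H_k,D}(u)=\min_{a\in H_k}\Bigl\|\sum_{i=1}^p a_i d_i-u\Bigr\|_2,\qquad H_k=\{a\in\mathbb{R}^p:\ a\text{ has at most }k\text{ nonzero entries}\},$$ and let $$\mu_{k-1}(D)=\max_{\Lambda\subset\{1,\dots,p\},\ |\Lambda|=k-1}\ \max_{i\notin\Lambda}\ \sum_{\lambda\in\Lambda}|\langle d_\lambda,d_i\rangle|$$ be its Babel function. Let $\delta<1$, let $x\ge 0$, and let $\nu$ be a probability distribution on the unit sphere $\mathbb{S}^{n-1}$ of $\mathbb{R}^n$. Then with probability at least $1-e^{-x}$ over $m$ samples $s_1,\dots,s_m$ drawn independently from $\nu$, all dictionaries $D$ of $p$ unit-length vectors in $\mathbb{R}^n$ with $\mu_{k-1}(D)\le\delta$ satisfy simultaneously $$\mathbb{E}_{u\sim\nu}\,h_{H_k,D}^2(u)\le \frac1m\sum_{j=1}^m h_{H_k,D}^2(s_j)+\frac{p}{\sqrt m}\left(\frac{14k}{1-\delta}+\frac12\sqrt{\ln\left(16m\left(\frac{k}{1-\delta}\right)^2\right)}\right)+\sqrt{\frac{x}{2m}}.$$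 -/

import Mathlib

open MeasureTheory

noncomputable section

namespace DictLearn

/-- The unit sphere `S^{n-1}` of the Euclidean space `ℝⁿ`. -/
abbrev Sphere (n : ℕ) : Type :=
  ↥(Metric.sphere (0 : EuclideanSpace ℝ (Fin n)) 1)

/-- A dictionary of `p` elements of `ℝⁿ`, given by its columns `d_1, …, d_p`. -/
abbrev Dictionary (n p : ℕ) : Type := Fin p → EuclideanSpace ℝ (Fin n)

/-- The linear combination `D a = ∑ i, a_i d_i`. -/
def synth {n p : ℕ} (D : Dictionary n p) (a : Fin p → ℝ) : EuclideanSpace ℝ (Fin n) :=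
  ∑ i, a i • D i

/-- `H_k = {a : ‖a‖₀ ≤ k}`: the coefficient vectors with at most `k` nonzero entries. -/
def sparseSet (p k : ℕ) : Set (Fin p → ℝ) := {a | hammingNorm a ≤ k}

/-- The representation error `h_{A,D}(x) = min_{a ∈ A} ‖D a - x‖`. For `A = H_k` the infimum
is attained, see `exists_repError_sparseSet_eq`. -/
def repError {n p : ℕ} (A : Set (Fin p → ℝ)) (D : Dictionary n p)
    (x : EuclideanSpace ℝ (Fin n)) : ℝ :=
  ⨅ a : A, ‖synth D (a : Fin p → ℝ) - x‖

/-- The Babel function `μ_k(D)`: the maximum, over the sets `Λ` of `k` indices and the indices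
`i ∉ Λ`, of `∑_{l ∈ Λ} |⟨d_l, d_i⟩|`. The set below is finite; it is nonempty for `k < p`. -/
def babel {n p : ℕ} (k : ℕ) (D : Dictionary n p) : ℝ :=
  sSup {s : ℝ | ∃ (Λ : Finset (Fin p)) (i : Fin p), Λ.card = k ∧ i ∉ Λ ∧
    s = ∑ l ∈ Λ, |inner ℝ (D l) (D i)|}

/-- The infimum that defines `h_{H_k,D}(x)` is a minimum. -/
theorem exists_repError_sparseSet_eq {n p : ℕ} (k : ℕ) (D : Dictionary n p)
    (x : EuclideanSpace ℝ (Fin n)) :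
    ∃ a ∈ sparseSet p k, ‖synth D a - x‖ = repError (sparseSet p k) D x := by
  classical
  -- the vectors `D a` with `a ∈ H_k` form a finite union of linear subspaces
  set S : Set (EuclideanSpace ℝ (Fin n)) := synth D '' sparseSet p k with hS
  have hU : S = ⋃ T ∈ {T : Finset (Fin p) | T.card ≤ k},
      (Submodule.span ℝ (D '' (T : Set (Fin p))) : Set (EuclideanSpace ℝ (Fin n))) := by
    ext y
    simp only [hS, Set.mem_image, Set.mem_iUnion, Set.mem_ofPred_eq, SetLike.mem_coe, exists_prop]
    constructor
    · rintro ⟨a, ha, rfl⟩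
      refine ⟨Finset.univ.filter (fun i => a i ≠ 0), ha, ?_⟩
      refine Submodule.sum_mem _ fun i _ => ?_
      by_cases h : a i = 0
      · simp [h]
      · exact Submodule.smul_mem _ _ (Submodule.subset_span ⟨i, by simp [h], rfl⟩)
    · rintro ⟨T, hT, hy⟩
      obtain ⟨c, rfl⟩ := (Submodule.mem_span_image_finset_iff_exists_fun ℝ).1 hy
      refine ⟨fun i => if h : i ∈ T then c ⟨i, h⟩ else 0, ?_, ?_⟩
      · refine le_trans (Finset.card_le_card fun i hi => ?_) hT
        by_contra h
        simp [h] at hi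
      · rw [synth, ← Finset.sum_subset (Finset.subset_univ T) (fun i _ hi => by simp [hi]),
          ← Finset.sum_coe_sort]
        exact Finset.sum_congr rfl fun i _ => by simp
  have hcl : IsClosed S := by
    rw [hU]
    exact (Set.toFinite _).isClosed_biUnion fun T _ => Submodule.closed_of_finiteDimensional _
  have hne : S.Nonempty := ⟨_, 0, by simp [sparseSet], rfl⟩
  obtain ⟨y, ⟨a, ha, rfl⟩, hy⟩ := hcl.exists_infDist_eq_dist hne x
  refine ⟨a, ha, le_antisymm ?_ ?_⟩
  · have : Nonempty (sparseSet p k) := ⟨⟨a, ha⟩⟩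
    refine le_ciInf fun b => ?_
    rw [← dist_eq_norm, ← dist_eq_norm, dist_comm, ← hy, dist_comm]
    exact Metric.infDist_le_dist_of_mem ⟨_, b.2, rfl⟩
  · exact ciInf_le ⟨0, by rintro _ ⟨b, rfl⟩; exact norm_nonneg _⟩ (⟨a, ha⟩ : sparseSet p k)

end DictLearn

end

open scoped BigOperators

namespace DictLearn

/-! ### Averages over random signs -/

/-! On unit vectors `u`, the squared error is the minimum over sparse `a` of `aᵀ G a - 2 ⟨a, Dᵀ u⟩ +
1`, so it depends on `D` only through the Gram matrix `G` and the `p` inner products `Dᵀ u`. The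
Babel condition makes `G` well conditioned on sparse vectors (`one_sub_mul_sum_sq_le`), so optimal
coefficients satisfy `‖a‖₂² ≤ 1 / (1 - δ)` and `‖a‖₁² ≤ k / (1 - δ)`. Hence the squared error is
Lipschitz in `Dᵀ u` with constant `2 / √(1 - δ)`, up to `k / (1 - δ)` times the entrywise change of
`G` (`repError_sq_sub_le`).

The dictionaries are sorted into `r ^ (p * p)` cells by rounding the entries of `G` to intervals of
length `2 / r`; this number does not involve the dimension `n`. Inside a cell only the dependence on
`Dᵀ u` matters. The vector contraction principle (`expect_iSup_add_signSum_le`), a consequence of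
Khintchine's inequality, replaces the Rademacher average of the squared errors by that of linear
forms, which is at most `p √m` since a sum of `m` unit vectors with random signs has mean norm at
most `√m`.

Symmetrization and McDiarmid's inequality turn this into a uniform deviation bound on each cell
(`exists_measurableSet_deviation_le`). A union bound over the cells adds `p² log r` to `x` in the
deviation term, and `r ≈ 4 √m k / (1 - δ)` makes the rounding error as small as the Rademacher term.
This produces the logarithm in the result. -/

theorem expect_fin_cons {T : Type*} [Fintype T] {m : ℕ} (f : (Fin (m + 1) → T) → ℝ) :
    𝔼 t, f t = 𝔼 a : T, 𝔼 t : Fin m → T, f (Fin.cons a t) := by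
  rw [← Finset.expect_product' Finset.univ Finset.univ
    (fun (a : T) (t : Fin m → T) => f (Fin.cons a t)), Finset.univ_product_univ]
  exact (Fintype.expect_equiv (Fin.consEquiv fun _ => T) _ _ fun _ => rfl).symm

theorem expect_units (f : ℤˣ → ℝ) : 𝔼 e, f e = (f 1 + f (-1)) / 2 := by
  rw [Fintype.expect_eq_sum_div_card]
  simp [Finset.sum_pair (show (1 : ℤˣ) ≠ -1 by decide)]

/-- A linear form evaluated at a vector of signs. -/
def signSum {p : ℕ} (t : Fin p → ℤˣ) (x : Fin p → ℝ) : ℝ := ∑ i, ((t i : ℤ) : ℝ) * x i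

theorem signSum_neg {p : ℕ} (t : Fin p → ℤˣ) (x : Fin p → ℝ) :
    signSum (-t) x = -signSum t x := by
  simp [signSum]

theorem signSum_sub {p : ℕ} (t : Fin p → ℤˣ) (x y : Fin p → ℝ) :
    signSum t (fun i => x i - y i) = signSum t x - signSum t y := by
  simp [signSum, mul_sub, Finset.sum_sub_distrib]

theorem expect_signSum_sq {p : ℕ} (x : Fin p → ℝ) :
    𝔼 t : Fin p → ℤˣ, signSum t x ^ 2 = ∑ i, x i ^ 2 := by
  induction p with
  | zero => simp [signSum]
  | succ p ih =>
    rw [expect_fin_cons, expect_units, Fin.sum_univ_succ, ← ih, ← Finset.expect_add_distrib,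
      Finset.expect_div]
    rw [← Fintype.expect_const (ι := Fin p → ℤˣ) (x 0 ^ 2), ← Finset.expect_add_distrib]
    refine Finset.expect_congr rfl fun t _ => ?_
    simp only [signSum, Fin.sum_univ_succ, Fin.cons_zero, Fin.cons_succ]
    push_cast
    ring

/-- Averaging over one sign kills the odd powers, leaving `x₀⁴ + 6 x₀² E S² + E S⁴` with `S` the sum
over the other coordinates. The induction closes because `6 = 2 * 3` and `1 ≤ 3`. -/
theorem expect_signSum_pow_four_le {p : ℕ} (x : Fin p → ℝ) :
    𝔼 t : Fin p → ℤˣ, signSum t x ^ 4 ≤ 3 * (∑ i, x i ^ 2) ^ 2 := by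
  induction p with
  | zero => simp [signSum]
  | succ p ih =>
    have key : 𝔼 t : Fin (p + 1) → ℤˣ, signSum t x ^ 4 = x 0 ^ 4
        + 6 * x 0 ^ 2 * (∑ i : Fin p, x i.succ ^ 2)
        + 𝔼 t : Fin p → ℤˣ, signSum t (fun i => x i.succ) ^ 4 := by
      rw [expect_fin_cons, expect_units, ← Finset.expect_add_distrib, Finset.expect_div,
        ← expect_signSum_sq, Finset.mul_expect,
        ← Fintype.expect_const (ι := Fin p → ℤˣ) (x 0 ^ 4), ← Finset.expect_add_distrib,
        ← Finset.expect_add_distrib]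
      refine Finset.expect_congr rfl fun t _ => ?_
      simp only [signSum, Fin.sum_univ_succ, Fin.cons_zero, Fin.cons_succ]
      push_cast
      ring
    rw [key, Fin.sum_univ_succ]
    nlinarith [ih fun i => x i.succ, sq_nonneg (x 0 ^ 2)]

/-- Khintchine's inequality, with the constant `1 / 2`. -/
theorem half_sqrt_le_expect_abs_signSum {p : ℕ} (x : Fin p → ℝ) :
    1 / 2 * √(∑ i, x i ^ 2) ≤ 𝔼 t : Fin p → ℤˣ, |signSum t x| := by
  set q := √(∑ i, x i ^ 2) with hq
  have hQ : ∑ i, x i ^ 2 = q ^ 2 :=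
    (Real.sq_sqrt (Finset.sum_nonneg fun i _ => sq_nonneg (x i))).symm
  rcases (Real.sqrt_nonneg (∑ i, x i ^ 2)).eq_or_lt with h0 | hpos
  · rw [hq, ← h0, mul_zero]
    exact Finset.expect_nonneg fun t _ => abs_nonneg _
  rw [← hq] at hpos
  -- A minorant of `|s|` by second and fourth powers, scaled by `q`, reduces the claim to the two
  -- moments: `17/20 - 3 * (1/10) = 11/20 ≥ 1/2`.
  have hpt : ∀ s : ℝ, 17 / 20 / q * s ^ 2 - 1 / 10 / q ^ 3 * s ^ 4 ≤ |s| := by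
    intro s
    obtain ⟨u, hu⟩ : ∃ u, |s| = q * u := ⟨|s| / q, by field_simp⟩
    have hu0 : 0 ≤ u := nonneg_of_mul_nonneg_right (hu ▸ abs_nonneg s) hpos
    have h2 : s ^ 2 = (q * u) ^ 2 := by rw [← hu, sq_abs]
    have h4 : s ^ 4 = (q * u) ^ 4 := by rw [show s ^ 4 = (s ^ 2) ^ 2 by ring, h2]; ring
    rw [hu, h2, h4]
    have : 17 / 20 / q * (q * u) ^ 2 - 1 / 10 / q ^ 3 * (q * u) ^ 4
        = q * (17 / 20 * u ^ 2 - 1 / 10 * u ^ 4) := by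
      field_simp
    rw [this]
    refine mul_le_mul_of_nonneg_left ?_ hpos.le
    have : 0 ≤ 1 - 17 / 20 * u + 1 / 10 * u ^ 3 := by
      -- The cubic has its minimum near `17/10`. A tenth of the product, which has a double root
      -- there and no quadratic term, lies below it for `u ≥ 0`.
      nlinarith [mul_nonneg (sq_nonneg (u - 17 / 10)) (show (0 : ℝ) ≤ u + 34 / 10 by linarith)]
    nlinarith
  calc 1 / 2 * q ≤ 17 / 20 / q * q ^ 2 - 1 / 10 / q ^ 3 * (3 * (q ^ 2) ^ 2) := by
        have : 17 / 20 / q * q ^ 2 - 1 / 10 / q ^ 3 * (3 * (q ^ 2) ^ 2) = 11 / 20 * q := by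
          field_simp
          norm_num
        rw [this]
        linarith
    _ ≤ 17 / 20 / q * 𝔼 t : Fin p → ℤˣ, signSum t x ^ 2
        - 1 / 10 / q ^ 3 * 𝔼 t : Fin p → ℤˣ, signSum t x ^ 4 := by
        rw [expect_signSum_sq, hQ]
        have := expect_signSum_pow_four_le x
        rw [hQ] at this
        gcongr
    _ ≤ 𝔼 t : Fin p → ℤˣ, |signSum t x| := by
        rw [Finset.mul_expect, Finset.mul_expect, ← Finset.expect_sub_distrib]
        exact Finset.expect_le_expect fun t _ => hpt _

/-- For vectors with random signs, the squared norm is additive in expectation. -/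
theorem expect_norm_add_sum_sign_smul_sq {E : Type*} [NormedAddCommGroup E]
    [InnerProductSpace ℝ E] {m p : ℕ} (i : Fin p) (v : E) (w : Fin m → E) :
    𝔼 t : Fin m → Fin p → ℤˣ, ‖v + ∑ j, ((t j i : ℤ) : ℝ) • w j‖ ^ 2
      = ‖v‖ ^ 2 + ∑ j, ‖w j‖ ^ 2 := by
  induction m generalizing v with
  | zero => simp
  | succ m ih =>
    rw [expect_fin_cons]
    simp only [Fin.sum_univ_succ, Fin.cons_zero, Fin.cons_succ, ← add_assoc, ih]
    rw [Finset.expect_add_distrib, Fintype.expect_const]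
    congr 1
    have hneg : 𝔼 a : Fin p → ℤˣ, ‖v + ((a i : ℤ) : ℝ) • w 0‖ ^ 2
        = 𝔼 a : Fin p → ℤˣ, ‖v - ((a i : ℤ) : ℝ) • w 0‖ ^ 2 :=
      Fintype.expect_equiv (Equiv.neg _) _ _ fun a => by simp
    have hadd : 𝔼 a : Fin p → ℤˣ, ‖v + ((a i : ℤ) : ℝ) • w 0‖ ^ 2
        + 𝔼 a : Fin p → ℤˣ, ‖v - ((a i : ℤ) : ℝ) • w 0‖ ^ 2 = 2 * (‖v‖ ^ 2 + ‖w 0‖ ^ 2) := by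
      rw [← Finset.expect_add_distrib,
        ← Fintype.expect_const (ι := Fin p → ℤˣ) (2 * (‖v‖ ^ 2 + ‖w 0‖ ^ 2))]
      refine Finset.expect_congr rfl fun a _ => ?_
      have := parallelogram_law_with_norm ℝ v (((a i : ℤ) : ℝ) • w 0)
      have h1 : ‖((a i : ℤ) : ℝ) • w 0‖ = ‖w 0‖ := by
        rcases Int.units_eq_one_or (a i) with h | h <;> simp [h]
      rw [h1] at this
      linarith
    linarith

/-- The comparison step of the contraction principle: one random sign in front of a function that
is Lipschitz in `φ`, up to an additive error, is replaced by a vector of random signs. -/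
theorem expect_iSup_add_sign_le {Θ : Type*} [Nonempty Θ] {p : ℕ} (A ψ : Θ → ℝ)
    (φ : Θ → Fin p → ℝ) (L e : ℝ) (hL : 0 ≤ L)
    (hB : ∀ t : Fin p → ℤˣ, BddAbove (Set.range fun θ => A θ + 2 * L * signSum t (φ θ)))
    (h : ∀ θ θ', ψ θ - ψ θ' ≤ L * √(∑ i, (φ θ i - φ θ' i) ^ 2) + e) :
    𝔼 s : ℤˣ, (⨆ θ, (A θ + ((s : ℤ) : ℝ) * ψ θ))
      ≤ (𝔼 t : Fin p → ℤˣ, ⨆ θ, (A θ + 2 * L * signSum t (φ θ))) + e / 2 := by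
  set S : (Fin p → ℤˣ) → ℝ := fun t => ⨆ θ, (A θ + 2 * L * signSum t (φ θ)) with hS
  have hle : ∀ t θ, A θ + 2 * L * signSum t (φ θ) ≤ S t := fun t θ => le_ciSup (hB t) θ
  have hSneg : 𝔼 t, S (-t) = 𝔼 t, S t := Fintype.expect_equiv (Equiv.neg _) _ _ fun a => by simp
  -- Khintchine bounds the Euclidean distance by `2 E |signSum t (φ θ - φ θ')|`. For each `t`, the
  -- absolute value is removed by giving `t` to one of `θ`, `θ'` and `-t` to the other, and `S t`,
  -- `S (-t)` have the same average.
  have hpair : ∀ θ θ', A θ + ψ θ + (A θ' - ψ θ') ≤ 2 * (𝔼 t, S t) + e := by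
    intro θ θ'
    have h1 := half_sqrt_le_expect_abs_signSum fun i => φ θ i - φ θ' i
    have h2 : 𝔼 t : Fin p → ℤˣ, (A θ + A θ' + 2 * L * |signSum t fun i => φ θ i - φ θ' i|)
        ≤ 𝔼 t, (S t + S (-t)) := by
      refine Finset.expect_le_expect fun t _ => ?_
      rw [signSum_sub]
      have a1 := hle t θ
      have a2 := hle t θ'
      have a3 := hle (-t) θ
      have a4 := hle (-t) θ'
      rw [signSum_neg] at a3 a4
      rcases abs_cases (signSum t (φ θ) - signSum t (φ θ')) with h | h <;> rw [h.1] <;> linarith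
    rw [Finset.expect_add_distrib, Fintype.expect_const, Finset.expect_add_distrib, hSneg,
      ← Finset.mul_expect] at h2
    have h3 := mul_le_mul_of_nonneg_left h1 (show 0 ≤ 2 * L by linarith)
    have h4 := h θ θ'
    linarith
  rw [expect_units]
  have h1 : ∀ θ', (⨆ θ, (A θ + (((1 : ℤˣ) : ℤ) : ℝ) * ψ θ))
      ≤ 2 * (𝔼 t, S t) + e - (A θ' - ψ θ') := fun θ' => ciSup_le fun θ => by
    have := hpair θ θ'
    simp only [Units.val_one, Int.cast_one, one_mul]
    linarith
  have h2 : (⨆ θ', (A θ' + (((-1 : ℤˣ) : ℤ) : ℝ) * ψ θ'))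
      ≤ 2 * (𝔼 t, S t) + e - ⨆ θ, (A θ + (((1 : ℤˣ) : ℤ) : ℝ) * ψ θ) := ciSup_le fun θ' => by
    have := h1 θ'
    simp only [Units.val_neg, Units.val_one, Int.cast_neg, Int.cast_one, neg_mul, one_mul]
      at this ⊢
    linarith
  linarith

theorem abs_signSum_le {p : ℕ} (t : Fin p → ℤˣ) (x : Fin p → ℝ) : |signSum t x| ≤ ∑ i, |x i| := by
  refine (Finset.abs_sum_le_sum_abs _ _).trans (Finset.sum_le_sum fun i _ => ?_)
  rcases Int.units_eq_one_or (t i) with h | h <;> simp [h]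

theorem bddAbove_add_of_abs_le {Θ : Type*} {A f : Θ → ℝ} {C : ℝ} (hA : BddAbove (Set.range A))
    (hf : ∀ θ, |f θ| ≤ C) : BddAbove (Set.range fun θ => A θ + f θ) := by
  obtain ⟨K, hK⟩ := hA
  refine ⟨K + C, ?_⟩
  rintro _ ⟨θ, rfl⟩
  exact add_le_add (hK ⟨θ, rfl⟩) ((le_abs_self _).trans (hf θ))

/-- The vector contraction principle for Rademacher averages. -/
theorem expect_iSup_add_signSum_le {Θ : Type*} [Nonempty Θ] {m p : ℕ} (A : Θ → ℝ)
    (ψ : Fin m → Θ → ℝ) (φ : Fin m → Θ → Fin p → ℝ) (L e C : ℝ) (hL : 0 ≤ L)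
    (hA : BddAbove (Set.range A)) (hψ : ∀ j θ, |ψ j θ| ≤ C) (hφ : ∀ j θ i, |φ j θ i| ≤ C)
    (h : ∀ j θ θ', ψ j θ - ψ j θ' ≤ L * √(∑ i, (φ j θ i - φ j θ' i) ^ 2) + e) :
    𝔼 s : Fin m → ℤˣ, (⨆ θ, (A θ + ∑ j, ((s j : ℤ) : ℝ) * ψ j θ))
      ≤ (𝔼 t : Fin m → Fin p → ℤˣ, ⨆ θ, (A θ + 2 * L * ∑ j, signSum (t j) (φ j θ)))
        + m * (e / 2) := by
  have hsgn : ∀ j (t : Fin p → ℤˣ) θ, |2 * L * signSum t (φ j θ)| ≤ 2 * L * (p * C) := by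
    intro j t θ
    rw [abs_mul, abs_of_nonneg (by linarith : (0 : ℝ) ≤ 2 * L)]
    refine mul_le_mul_of_nonneg_left ((abs_signSum_le _ _).trans ?_) (by linarith)
    refine (Finset.sum_le_sum fun i _ => hφ j θ i).trans ?_
    simp
  induction m generalizing A with
  | zero => simp
  | succ m ih =>
    rw [expect_fin_cons, expect_fin_cons (T := Fin p → ℤˣ)]
    simp only [Fin.sum_univ_succ, Fin.cons_zero, Fin.cons_succ, mul_add, ← add_assoc]
    have h1 : ∀ a : ℤˣ, BddAbove (Set.range fun θ => A θ + ((a : ℤ) : ℝ) * ψ 0 θ) := fun a =>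
      bddAbove_add_of_abs_le hA (C := C) fun θ => by
        rcases Int.units_eq_one_or a with h | h <;> simpa [h] using hψ 0 θ
    -- The signs are replaced one at a time. Here the term of sign `0` is absorbed into `A` while
    -- the others are replaced; below, the replaced terms are absorbed instead and the comparison
    -- step treats sign `0`.
    have h2 := Finset.expect_le_expect (s := Finset.univ) fun (a : ℤˣ) _ =>
      ih (fun θ => A θ + ((a : ℤ) : ℝ) * ψ 0 θ) (fun j => ψ j.succ) (fun j => φ j.succ) (h1 a)
        (fun j => hψ j.succ) (fun j => hφ j.succ) (fun j => h j.succ) (fun j => hsgn j.succ)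
    refine h2.trans ?_
    rw [Finset.expect_add_distrib, Fintype.expect_const, Finset.expect_comm,
      Finset.expect_comm (s := (Finset.univ : Finset (Fin p → ℤˣ)))]
    have hbig : ∀ t : Fin m → Fin p → ℤˣ, BddAbove (Set.range fun θ =>
        A θ + 2 * L * ∑ j, signSum (t j) (φ j.succ θ)) := fun t =>
      bddAbove_add_of_abs_le hA (C := m * (2 * L * (p * C))) fun θ => by
        rw [Finset.mul_sum]
        refine (Finset.abs_sum_le_sum_abs _ _).trans
          ((Finset.sum_le_sum fun j _ => hsgn j.succ (t j) θ).trans ?_)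
        simp
    have h3 := Finset.expect_le_expect (s := Finset.univ) fun (t : Fin m → Fin p → ℤˣ) _ =>
      expect_iSup_add_sign_le (fun θ => A θ + 2 * L * ∑ j, signSum (t j) (φ j.succ θ)) (ψ 0) (φ 0)
        L e hL (fun u => bddAbove_add_of_abs_le (hbig t) (hsgn 0 u)) (h 0)
    rw [Finset.expect_add_distrib, Fintype.expect_const] at h3
    simp only [add_right_comm _ (2 * L * ∑ j, _)] at h3
    push_cast
    linarith

end DictLearn

namespace DictLearn

/-! ### The bounded differences inequality -/

theorem measurePreserving_fin_cons {Ω : Type*} [MeasurableSpace Ω] (ν : Measure Ω)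
    [IsProbabilityMeasure ν] (m : ℕ) :
    MeasurePreserving (fun q : Ω × (Fin m → Ω) => (Fin.cons q.1 q.2 : Fin (m + 1) → Ω))
      (ν.prod (Measure.pi fun _ : Fin m => ν)) (Measure.pi fun _ : Fin (m + 1) => ν) := by
  have := (measurePreserving_piFinSuccAbove (fun _ : Fin (m + 1) => ν) 0).symm
  convert this using 1
  ext q i
  simp [MeasurableEquiv.piFinSuccAbove, Fin.insertNthEquiv]

theorem integrable_of_abs_le {X : Type*} [MeasurableSpace X] {μ : Measure X} [IsFiniteMeasure μ]
    {f : X → ℝ} {K : ℝ} (hf : Measurable f) (hK : ∀ x, |f x| ≤ K) : Integrable f μ :=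
  Integrable.of_bound hf.aestronglyMeasurable K (Filter.Eventually.of_forall hK)

theorem integral_fin_cons {Ω : Type*} [MeasurableSpace Ω] (ν : Measure Ω)
    [IsProbabilityMeasure ν] {m : ℕ} {f : (Fin (m + 1) → Ω) → ℝ} (hf : Measurable f) {K : ℝ}
    (hK : ∀ s, |f s| ≤ K) :
    ∫ s, f s ∂Measure.pi (fun _ : Fin (m + 1) => ν)
      = ∫ ω, ∫ s, f (Fin.cons ω s) ∂Measure.pi (fun _ : Fin m => ν) ∂ν := by
  have hmp := measurePreserving_fin_cons ν m
  rw [← hmp.map_eq, integral_map hmp.measurable.aemeasurable hf.aestronglyMeasurable]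
  exact integral_prod _ (integrable_of_abs_le (hf.comp hmp.measurable) fun _ => hK _)

theorem abs_integral_le_of_abs_le {X : Type*} [MeasurableSpace X] {μ : Measure X}
    [IsProbabilityMeasure μ] {f : X → ℝ} {K : ℝ} (hK : ∀ x, |f x| ≤ K) : |∫ x, f x ∂μ| ≤ K := by
  simpa using norm_integral_le_of_norm_le_const (μ := μ) (f := f) (C := K)
    (Filter.Eventually.of_forall hK)

/-- McDiarmid's bounded differences inequality, for the moment generating function. -/
theorem integral_exp_sub_integral_le {Ω : Type*} [MeasurableSpace Ω] (ν : Measure Ω)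
    [IsProbabilityMeasure ν] {m : ℕ} {f : (Fin m → Ω) → ℝ} (hf : Measurable f) {K c : ℝ}
    (hK : ∀ s, |f s| ≤ K) (hc : 0 ≤ c)
    (hd : ∀ s j ω, |f (Function.update s j ω) - f s| ≤ c) (t : ℝ) :
    ∫ s, Real.exp (t * (f s - ∫ s', f s' ∂Measure.pi (fun _ : Fin m => ν)))
      ∂Measure.pi (fun _ : Fin m => ν) ≤ Real.exp (m * (c / 2) ^ 2 * t ^ 2 / 2) := by
  induction m with
  | zero =>
    have : ∀ s, f s = f default := fun s => congrArg f (Subsingleton.elim _ _)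
    simp [this]
  | succ m ih =>
    have hcons : Measurable fun q : Ω × (Fin m → Ω) => (Fin.cons q.1 q.2 : Fin (m + 1) → Ω) :=
      (measurePreserving_fin_cons ν m).measurable
    have hslice : ∀ ω, Measurable fun s : Fin m → Ω => f (Fin.cons ω s) := fun ω =>
      (hf.comp hcons).comp measurable_prodMk_left
    -- The conditional mean given the first coordinate. The induction hypothesis handles the
    -- fluctuation around `g ω`, and Hoeffding's lemma that of `g` around `M`; the exponents add.
    set g : Ω → ℝ := fun ω => ∫ s, f (Fin.cons ω s) ∂Measure.pi (fun _ : Fin m => ν) with hg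
    have hgm : Measurable g :=
      ((hf.comp hcons).stronglyMeasurable.integral_prod_right' (ν := Measure.pi _)).measurable
    have hgK : ∀ ω, |g ω| ≤ K := fun ω => abs_integral_le_of_abs_le fun s => hK _
    have hgc : ∀ ω ω', |g ω - g ω'| ≤ c := by
      intro ω ω'
      rw [hg, ← integral_sub (integrable_of_abs_le (hslice ω) fun s => hK _)
        (integrable_of_abs_le (hslice ω') fun s => hK _)]
      refine abs_integral_le_of_abs_le fun s => ?_
      simpa [Fin.update_cons_zero] using hd (Fin.cons ω' s) 0 ω
    set M := ∫ s, f s ∂Measure.pi (fun _ : Fin (m + 1) => ν) with hM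
    have hMg : M = ∫ ω, g ω ∂ν := integral_fin_cons ν hf hK
    have hexpm : Measurable fun s => Real.exp (t * (f s - M)) := by fun_prop
    have hbd : ∀ a b : ℝ, |a| ≤ K → |b| ≤ K →
        |Real.exp (t * (a - b))| ≤ Real.exp (|t| * (2 * K)) := by
      intro a b ha hb
      rw [Real.abs_exp, Real.exp_le_exp]
      refine (le_abs_self _).trans ?_
      rw [abs_mul]
      exact mul_le_mul_of_nonneg_left ((abs_sub _ _).trans (by linarith)) (abs_nonneg t)
    rw [integral_fin_cons ν hexpm fun s => hbd _ _ (hK s) (abs_integral_le_of_abs_le hK)]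
    have hinner : ∀ ω, ∫ s, Real.exp (t * (f (Fin.cons ω s) - M)) ∂Measure.pi (fun _ : Fin m => ν)
        ≤ Real.exp (m * (c / 2) ^ 2 * t ^ 2 / 2) * Real.exp (t * (g ω - M)) := by
      intro ω
      have := ih (hslice ω) (fun s => hK _) fun s j ω' => by
        have := hd (Fin.cons ω s) j.succ ω'
        rwa [← Fin.cons_update] at this
      rw [mul_comm]
      refine le_trans (le_of_eq ?_) (mul_le_mul_of_nonneg_left this (Real.exp_nonneg _))
      rw [← integral_const_mul]
      refine integral_congr_ae (Filter.Eventually.of_forall fun s => ?_)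
      simp only [← Real.exp_add]
      congr 1
      ring
    have hmgf : ∫ ω, Real.exp (t * (g ω - M)) ∂ν ≤ Real.exp ((c / 2) ^ 2 * t ^ 2 / 2) := by
      obtain ⟨ω₀⟩ : Nonempty Ω := nonempty_of_isProbabilityMeasure ν
      have hbb : BddBelow (Set.range g) :=
        ⟨-K, by rintro _ ⟨ω, rfl⟩; exact neg_le_of_abs_le (hgK ω)⟩
      -- The oscillation of `g` is at most `c`, so it takes values in an interval of length `c`
      -- starting at its infimum; Hoeffding's variance proxy is then `(c / 2) ^ 2`.
      have hH := (ProbabilityTheory.hasSubgaussianMGF_of_mem_Icc (μ := ν) (X := g)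
        (a := ⨅ ω, g ω) (b := (⨅ ω, g ω) + c) hgm.aemeasurable
        (Filter.Eventually.of_forall fun ω => ⟨ciInf_le hbb ω, by
          have : Nonempty Ω := ⟨ω⟩
          have : g ω - c ≤ ⨅ ω, g ω := le_ciInf fun ω' => by
            linarith [le_of_abs_le (hgc ω ω')]
          linarith⟩)).mgf_le t
      rw [ProbabilityTheory.mgf, ← hMg] at hH
      simpa [abs_of_nonneg hc] using hH
    calc ∫ ω, ∫ s, Real.exp (t * (f (Fin.cons ω s) - M)) ∂Measure.pi (fun _ : Fin m => ν) ∂ν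
        ≤ ∫ ω, Real.exp (m * (c / 2) ^ 2 * t ^ 2 / 2) * Real.exp (t * (g ω - M)) ∂ν := by
          refine integral_mono_of_nonneg (Filter.Eventually.of_forall fun ω =>
            integral_nonneg fun s => Real.exp_nonneg _) ?_ (Filter.Eventually.of_forall hinner)
          refine Integrable.const_mul (integrable_of_abs_le (by fun_prop) fun ω =>
            hbd _ _ (hgK ω) (abs_integral_le_of_abs_le hK)) _
      _ ≤ Real.exp (m * (c / 2) ^ 2 * t ^ 2 / 2) * Real.exp ((c / 2) ^ 2 * t ^ 2 / 2) := by
          rw [integral_const_mul]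
          exact mul_le_mul_of_nonneg_left hmgf (Real.exp_nonneg _)
      _ = Real.exp ((m + 1 : ℕ) * (c / 2) ^ 2 * t ^ 2 / 2) := by
          rw [← Real.exp_add]
          congr 1
          push_cast
          ring

/-- McDiarmid's bounded differences inequality, for the upper tail. -/
theorem measureReal_integral_add_le_le_exp {Ω : Type*} [MeasurableSpace Ω] (ν : Measure Ω)
    [IsProbabilityMeasure ν] {m : ℕ} {f : (Fin m → Ω) → ℝ} (hf : Measurable f) {K c : ℝ}
    (hK : ∀ s, |f s| ≤ K) (hc : 0 ≤ c)
    (hd : ∀ s j ω, |f (Function.update s j ω) - f s| ≤ c) {τ : ℝ} (hτ : 0 ≤ τ) :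
    (Measure.pi fun _ : Fin m => ν).real
      {s | (∫ s', f s' ∂Measure.pi (fun _ : Fin m => ν)) + τ ≤ f s}
      ≤ Real.exp (-τ ^ 2 / (2 * (m * (c / 2) ^ 2))) := by
  set M := ∫ s', f s' ∂Measure.pi (fun _ : Fin m => ν) with hM
  have h : ProbabilityTheory.HasSubgaussianMGF (fun s => f s - M)
      (⟨m * (c / 2) ^ 2, by positivity⟩ : NNReal) (Measure.pi fun _ : Fin m => ν) := by
    refine ⟨fun t => ?_, fun t => integral_exp_sub_integral_le ν hf hK hc hd t⟩
    refine integrable_of_abs_le (K := Real.exp (|t| * (2 * K))) (by fun_prop) fun s => ?_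
    rw [Real.abs_exp, Real.exp_le_exp]
    refine (le_abs_self _).trans ?_
    rw [abs_mul]
    have h1 : |M| ≤ K := abs_integral_le_of_abs_le hK
    exact mul_le_mul_of_nonneg_left ((abs_sub _ _).trans (by linarith [hK s])) (abs_nonneg t)
  have := h.measure_ge_le hτ
  simp only [le_sub_iff_add_le'] at this
  exact this

end DictLearn

namespace DictLearn

/-! ### Uniform deviations over a class of functions -/

theorem bddAbove_range_of_abs_le {Θ : Type*} {f : Θ → ℝ} {C : ℝ} (hf : ∀ θ, |f θ| ≤ C) :
    BddAbove (Set.range f) :=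
  ⟨C, by rintro _ ⟨θ, rfl⟩; exact le_of_abs_le (hf θ)⟩

theorem abs_ciSup_le_of_abs_le {Θ : Type*} [Nonempty Θ] {f : Θ → ℝ} {C : ℝ}
    (hf : ∀ θ, |f θ| ≤ C) : |⨆ θ, f θ| ≤ C := by
  refine abs_le.2 ⟨?_, ciSup_le fun θ => le_of_abs_le (hf θ)⟩
  obtain ⟨θ⟩ := ‹Nonempty Θ›
  exact (neg_le_of_abs_le (hf θ)).trans (le_ciSup (bddAbove_range_of_abs_le hf) θ)

theorem abs_add_sum_le {Y : Type*} {m : ℕ} {C C' : ℝ} {c : ℝ} {g : Fin m → Y → ℝ}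
    (hc : |c| ≤ C') (hg : ∀ j y, |g j y| ≤ C) (z : Fin m → Y) :
    |c + ∑ j, g j (z j)| ≤ C' + m * C := by
  refine (abs_add_le _ _).trans (add_le_add hc ((Finset.abs_sum_le_sum_abs _ _).trans ?_))
  refine (Finset.sum_le_sum fun j _ => hg j (z j)).trans ?_
  simp

/-- A supremum of additive functions with equi-Lipschitz summands is measurable. -/
theorem measurable_iSup_add_sum {Y : Type*} [PseudoMetricSpace Y] [SecondCountableTopology Y]
    [MeasurableSpace Y] [BorelSpace Y] {Θ : Type*} [Nonempty Θ] {m : ℕ} {K C C' : ℝ}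
    {c : Θ → ℝ} {g : Fin m → Θ → Y → ℝ} (hK : 0 ≤ K) (hc : ∀ θ, |c θ| ≤ C')
    (hg : ∀ j θ y, |g j θ y| ≤ C) (hl : ∀ j θ y y', g j θ y ≤ g j θ y' + K * dist y y') :
    Measurable fun z : Fin m → Y => ⨆ θ, (c θ + ∑ j, g j θ (z j)) := by
  have hb : ∀ z : Fin m → Y, BddAbove (Set.range fun θ => c θ + ∑ j, g j θ (z j)) := fun z =>
    bddAbove_range_of_abs_le fun θ => abs_add_sum_le (g := fun j => g j θ) (hc θ)
      (fun j => hg j θ) z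
  -- The index set may be uncountable, so measurability comes from continuity: a common Lipschitz
  -- constant, here `m * K` for the sup metric, survives the supremum.
  have : LipschitzWith (⟨m * K, by positivity⟩ : NNReal)
      fun z : Fin m → Y => ⨆ θ, (c θ + ∑ j, g j θ (z j)) := by
    refine LipschitzWith.of_le_add_mul _ fun z z' => ciSup_le fun θ => ?_
    have h1 : ∑ j, g j θ (z j) ≤ ∑ j, g j θ (z' j) + m * K * dist z z' := by
      calc ∑ j, g j θ (z j) ≤ ∑ j, (g j θ (z' j) + K * dist z z') :=
            Finset.sum_le_sum fun j _ => (hl j θ _ _).trans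
              (add_le_add le_rfl (mul_le_mul_of_nonneg_left (dist_le_pi_dist z z' j) hK))
        _ = _ := by
            rw [Finset.sum_add_distrib]
            simp [mul_assoc]
    have h2 := le_ciSup (hb z') θ
    change _ ≤ (⨆ θ, (c θ + ∑ j, g j θ (z' j))) + m * K * dist z z'
    linarith
  exact this.continuous.measurable

/-- A class of functions with values in `[0, 1]` and a common Lipschitz constant. -/
structure IsUnitLipschitzClass {Ω Θ : Type*} [PseudoMetricSpace Ω] (F : Θ → Ω → ℝ) (K : ℝ) :
    Prop where
  nonneg_const : 0 ≤ K
  nonneg : ∀ θ ω, 0 ≤ F θ ω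
  le_one : ∀ θ ω, F θ ω ≤ 1
  le_add_mul_dist : ∀ θ ω ω', F θ ω ≤ F θ ω' + K * dist ω ω'

theorem abs_units_mul (e : ℤˣ) (y : ℝ) : |((e : ℤ) : ℝ) * y| = |y| := by
  rcases Int.units_eq_one_or e with h | h <;> simp [h]

/-- The supremum over a class of functions of a signed sum along a sample. -/
noncomputable def signedSup {Ω Θ : Type*} {m : ℕ} (F : Θ → Ω → ℝ) (e : Fin m → ℤˣ) (s : Fin m → Ω) : ℝ :=
  ⨆ θ, ∑ j, ((e j : ℤ) : ℝ) * F θ (s j)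

/-- The differences `(a, b) ↦ f b - f a` of the functions of a class. -/
def pairDiff {Ω Θ : Type*} (F : Θ → Ω → ℝ) (θ : Θ) (z : Ω × Ω) : ℝ := F θ z.2 - F θ z.1

/-- The supremum over a class of functions of `m` times the deviation of the empirical mean from
the mean. -/
noncomputable def deviation {Ω Θ : Type*} [MeasurableSpace Ω] {m : ℕ} (ν : Measure Ω) (F : Θ → Ω → ℝ)
    (s : Fin m → Ω) : ℝ :=
  ⨆ θ, (m * (∫ u, F θ u ∂ν) + ∑ j, -F θ (s j))

theorem abs_signed_sum_le {Y Θ : Type*} {m : ℕ} {F : Θ → Y → ℝ} (hF : ∀ θ y, |F θ y| ≤ 1)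
    (e : Fin m → ℤˣ) (s : Fin m → Y) (θ : Θ) : |∑ j, ((e j : ℤ) : ℝ) * F θ (s j)| ≤ m := by
  have := abs_add_sum_le (c := 0) (C' := 0) (C := 1) (g := fun j y => ((e j : ℤ) : ℝ) * F θ y)
    (by simp) (fun j y => by rw [abs_units_mul]; exact hF θ y) s
  simpa only [zero_add, mul_one] using this

theorem abs_signedSup_le {Y Θ : Type*} [Nonempty Θ] {m : ℕ} {F : Θ → Y → ℝ}
    (hF : ∀ θ y, |F θ y| ≤ 1) (e : Fin m → ℤˣ) (s : Fin m → Y) : |signedSup F e s| ≤ m :=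
  abs_ciSup_le_of_abs_le (abs_signed_sum_le hF e s)

theorem le_signedSup {Y Θ : Type*} {m : ℕ} {F : Θ → Y → ℝ} (hF : ∀ θ y, |F θ y| ≤ 1)
    (e : Fin m → ℤˣ) (s : Fin m → Y) (θ : Θ) :
    ∑ j, ((e j : ℤ) : ℝ) * F θ (s j) ≤ signedSup F e s :=
  le_ciSup (bddAbove_range_of_abs_le (abs_signed_sum_le hF e s)) θ

theorem measurable_signedSup {Y : Type*} [PseudoMetricSpace Y] [SecondCountableTopology Y]
    [MeasurableSpace Y] [BorelSpace Y] {Θ : Type*} [Nonempty Θ] {m : ℕ} {K : ℝ}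
    {F : Θ → Y → ℝ} (hK : 0 ≤ K) (hF : ∀ θ y, |F θ y| ≤ 1)
    (hl : ∀ θ y y', F θ y ≤ F θ y' + K * dist y y') (e : Fin m → ℤˣ) :
    Measurable (signedSup F e) := by
  have := measurable_iSup_add_sum (Y := Y) (m := m) (c := fun _ : Θ => 0) (C' := 0) (C := 1)
    (g := fun j θ y => ((e j : ℤ) : ℝ) * F θ y) (K := K) hK
    (by simp) (fun j θ y => by rw [abs_units_mul]; exact hF θ y)
    (fun j θ y y' => by
      have a1 := hl θ y y'
      have a3 := hl θ y' y
      rw [dist_comm] at a3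
      rcases Int.units_eq_one_or (e j) with h | h <;> simp [h] <;> linarith)
  simp only [zero_add] at this
  exact this

namespace IsUnitLipschitzClass

variable {Ω : Type*} [PseudoMetricSpace Ω] {Θ : Type*} {F : Θ → Ω → ℝ} {K : ℝ}

theorem abs_le_one (hF : IsUnitLipschitzClass F K) (θ : Θ) (ω : Ω) : |F θ ω| ≤ 1 :=
  abs_le.2 ⟨by linarith [hF.nonneg θ ω], hF.le_one θ ω⟩

theorem abs_pairDiff_le (hF : IsUnitLipschitzClass F K) (θ : Θ) (z : Ω × Ω) :
    |pairDiff F θ z| ≤ 1 :=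
  abs_le.2 ⟨by rw [pairDiff]; linarith [hF.nonneg θ z.2, hF.le_one θ z.1],
    by rw [pairDiff]; linarith [hF.le_one θ z.2, hF.nonneg θ z.1]⟩

theorem pairDiff_le (hF : IsUnitLipschitzClass F K) (θ : Θ) (y y' : Ω × Ω) :
    pairDiff F θ y ≤ pairDiff F θ y' + 2 * K * dist y y' := by
  have d1 : K * dist y.1 y'.1 ≤ K * dist y y' :=
    mul_le_mul_of_nonneg_left (le_max_left _ _) hF.nonneg_const
  have d2 : K * dist y.2 y'.2 ≤ K * dist y y' :=
    mul_le_mul_of_nonneg_left (le_max_right _ _) hF.nonneg_const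
  have a2 := hF.le_add_mul_dist θ y.2 y'.2
  have a3 := hF.le_add_mul_dist θ y'.1 y.1
  rw [dist_comm] at a3
  rw [pairDiff, pairDiff]
  linarith

variable [MeasurableSpace Ω]

variable {m : ℕ} (ν : Measure Ω) [IsProbabilityMeasure ν]

theorem abs_mul_integral_le (hF : IsUnitLipschitzClass F K) (θ : Θ) :
    |m * ∫ u, F θ u ∂ν| ≤ m * 1 := by
  rw [abs_mul, Nat.abs_cast]
  exact mul_le_mul_of_nonneg_left (abs_integral_le_of_abs_le (hF.abs_le_one θ)) (Nat.cast_nonneg m)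

theorem abs_deviation_term_le (hF : IsUnitLipschitzClass F K) (s : Fin m → Ω) (θ : Θ) :
    |m * (∫ u, F θ u ∂ν) + ∑ j, -F θ (s j)| ≤ m * 1 + m * 1 :=
  abs_add_sum_le (g := fun _ y => -F θ y) (hF.abs_mul_integral_le ν θ)
    (fun j y => by rw [abs_neg]; exact hF.abs_le_one θ y) s

theorem abs_deviation_le [Nonempty Θ] (hF : IsUnitLipschitzClass F K) (s : Fin m → Ω) :
    |deviation ν F s| ≤ m * 1 + m * 1 :=
  abs_ciSup_le_of_abs_le (hF.abs_deviation_term_le ν s)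

theorem le_deviation (hF : IsUnitLipschitzClass F K) (s : Fin m → Ω) (θ : Θ) :
    m * (∫ u, F θ u ∂ν) + ∑ j, -F θ (s j) ≤ deviation ν F s :=
  le_ciSup (bddAbove_range_of_abs_le (hF.abs_deviation_term_le ν s)) θ

variable [BorelSpace Ω]

theorem measurable (hF : IsUnitLipschitzClass F K) (θ : Θ) : Measurable (F θ) :=
  (LipschitzWith.of_le_add_mul ⟨K, hF.nonneg_const⟩
    fun x y => hF.le_add_mul_dist θ x y).continuous.measurable

variable [SecondCountableTopology Ω]

/-! ### Symmetrization -/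

section Nonempty

variable [Nonempty Θ]

theorem measurable_deviation (hF : IsUnitLipschitzClass F K) :
    Measurable (deviation (m := m) ν F) := by
  refine measurable_iSup_add_sum (C := 1) (g := fun _ θ y => -F θ y) hF.nonneg_const
    (hF.abs_mul_integral_le ν) (fun j θ y => by rw [abs_neg]; exact hF.abs_le_one θ y)
    fun j θ y y' => ?_
  have := hF.le_add_mul_dist θ y' y
  rw [dist_comm] at this
  linarith

/-- The ghost sample: each mean is the expectation of an empirical mean over an independent copy
`s'`, and the supremum of integrals is at most the integral of the supremum. -/
theorem deviation_le_integral_signedSup (hF : IsUnitLipschitzClass F K) (s : Fin m → Ω) :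
    deviation ν F s ≤ ∫ s', signedSup (pairDiff F) 1 (fun j => (s j, s' j))
      ∂Measure.pi (fun _ : Fin m => ν) := by
  refine ciSup_le fun θ => ?_
  have hint : ∀ j, Integrable (fun s' : Fin m → Ω => F θ (s' j)) (Measure.pi fun _ => ν) := fun j =>
    integrable_of_abs_le ((hF.measurable θ).comp (measurable_pi_apply j)) fun s' =>
      hF.abs_le_one θ _
  have e2 : ∫ s', (∑ j, F θ (s' j) + ∑ j, -F θ (s j)) ∂(Measure.pi fun _ : Fin m => ν)
      = m * (∫ u, F θ u ∂ν) + ∑ j, -F θ (s j) := by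
    rw [integral_add (integrable_finsetSum _ fun j _ => hint j) (integrable_const _),
      integral_finsetSum _ fun j _ => hint j]
    have e3 : ∀ j, ∫ s', F θ (s' j) ∂(Measure.pi fun _ : Fin m => ν) = ∫ u, F θ u ∂ν := fun j => by
      have hev := measurePreserving_eval (fun _ : Fin m => ν) j
      conv_rhs => rw [← hev.map_eq, integral_map hev.measurable.aemeasurable
        (hF.measurable θ).aestronglyMeasurable]
    simp [e3]
  rw [← e2]
  refine integral_mono ((integrable_finsetSum _ fun j _ => hint j).add (integrable_const _))
    (integrable_of_abs_le ((measurable_signedSup (by linarith [hF.nonneg_const]) hF.abs_pairDiff_le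
      hF.pairDiff_le 1).comp (by fun_prop)) fun s' =>
      abs_signedSup_le hF.abs_pairDiff_le _ _) fun s' => ?_
  refine le_trans (le_of_eq ?_) (le_signedSup hF.abs_pairDiff_le 1 (fun j => (s j, s' j)) θ)
  rw [← Finset.sum_add_distrib]
  exact Finset.sum_congr rfl fun j _ => by simp [pairDiff, sub_eq_add_neg]

theorem integral_deviation_le_integral_signedSup (hF : IsUnitLipschitzClass F K) :
    ∫ s, deviation ν F s ∂Measure.pi (fun _ : Fin m => ν)
      ≤ ∫ z, signedSup (pairDiff F) 1 z ∂Measure.pi (fun _ : Fin m => ν.prod ν) := by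
  have hWm := measurable_signedSup (m := m) (by linarith [hF.nonneg_const]) hF.abs_pairDiff_le
    hF.pairDiff_le 1
  have hmp := (measurePreserving_arrowProdEquivProdArrow Ω Ω (Fin m)
    (fun _ => ν) (fun _ => ν)).symm
  have hpairm : Measurable fun q : (Fin m → Ω) × (Fin m → Ω) =>
      signedSup (pairDiff F) 1 fun j => (q.1 j, q.2 j) := hWm.comp (by fun_prop)
  have e1 : ∫ z, signedSup (pairDiff F) 1 z ∂Measure.pi (fun _ : Fin m => ν.prod ν)
      = ∫ s, ∫ s', signedSup (pairDiff F) 1 (fun j => (s j, s' j))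
          ∂Measure.pi (fun _ : Fin m => ν) ∂Measure.pi (fun _ : Fin m => ν) := by
    rw [← hmp.integral_comp' (g := signedSup (pairDiff F) 1)]
    exact integral_prod (fun q : (Fin m → Ω) × (Fin m → Ω) =>
      signedSup (pairDiff F) 1 fun j => (q.1 j, q.2 j))
      (integrable_of_abs_le hpairm fun q => abs_signedSup_le hF.abs_pairDiff_le _ _)
  rw [e1]
  exact integral_mono (integrable_of_abs_le (hF.measurable_deviation ν) (hF.abs_deviation_le ν))
    (integrable_of_abs_le
      (hpairm.stronglyMeasurable.integral_prod_right' (ν := Measure.pi _)).measurable fun s =>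
      abs_integral_le_of_abs_le fun s' => abs_signedSup_le hF.abs_pairDiff_le _ _)
    (hF.deviation_le_integral_signedSup ν)

/-- Exchanging the two samples in some coordinates changes signs. -/
theorem integral_signedSup_pairDiff (hF : IsUnitLipschitzClass F K) (e : Fin m → ℤˣ) :
    ∫ z, signedSup (pairDiff F) 1 z ∂Measure.pi (fun _ : Fin m => ν.prod ν)
      = ∫ z, signedSup (pairDiff F) e z ∂Measure.pi (fun _ : Fin m => ν.prod ν) := by
  have hWm := measurable_signedSup (m := m) (by linarith [hF.nonneg_const]) hF.abs_pairDiff_le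
    hF.pairDiff_le 1
  -- Swapping the two entries of a pair preserves `ν.prod ν` and negates `pairDiff`; it is done
  -- exactly where `e j = -1`.
  let σ : Fin m → Ω × Ω → Ω × Ω := fun j => if e j = 1 then id else Prod.swap
  have hσ : ∀ j, MeasurePreserving (σ j) (ν.prod ν) (ν.prod ν) := fun j => by
    by_cases h : e j = 1
    · simpa [σ, h] using MeasurePreserving.id (ν.prod ν)
    · simpa [σ, h] using Measure.measurePreserving_swap (μ := ν) (ν := ν)
  have hmp := measurePreserving_pi (fun _ : Fin m => ν.prod ν) (fun _ => ν.prod ν) hσ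
  conv_lhs => rw [← hmp.map_eq,
    integral_map hmp.measurable.aemeasurable hWm.aestronglyMeasurable]
  refine integral_congr_ae (Filter.Eventually.of_forall fun z => ?_)
  refine iSup_congr fun θ => Finset.sum_congr rfl fun j _ => ?_
  rcases Int.units_eq_one_or (e j) with h | h
  · simp [σ, h]
  · simp [σ, h, pairDiff]

/-- The supremum of a difference splits into two suprema. The minus sign passes to `-e`, which has
the same average as `e`; this is the factor 2 of symmetrization. -/
theorem integral_signedSup_pairDiff_le (hF : IsUnitLipschitzClass F K) (e : Fin m → ℤˣ) :
    ∫ z, signedSup (pairDiff F) e z ∂Measure.pi (fun _ : Fin m => ν.prod ν)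
      ≤ ∫ s, signedSup F e s ∂Measure.pi (fun _ : Fin m => ν)
        + ∫ s, signedSup F (-e) s ∂Measure.pi (fun _ : Fin m => ν) := by
  have hHm := fun e => measurable_signedSup (m := m) (e := e) hF.nonneg_const hF.abs_le_one
    hF.le_add_mul_dist
  have hWm := measurable_signedSup (m := m) (by linarith [hF.nonneg_const]) hF.abs_pairDiff_le
    hF.pairDiff_le e
  have hfst : MeasurePreserving (fun (z : Fin m → Ω × Ω) j => (z j).1)
      (Measure.pi fun _ => ν.prod ν) (Measure.pi fun _ => ν) :=
    measurePreserving_pi (fun _ : Fin m => ν.prod ν) (fun _ => ν) fun _ =>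
      measurePreserving_fst (μ := ν) (ν := ν)
  have hsnd : MeasurePreserving (fun (z : Fin m → Ω × Ω) j => (z j).2)
      (Measure.pi fun _ => ν.prod ν) (Measure.pi fun _ => ν) :=
    measurePreserving_pi (fun _ : Fin m => ν.prod ν) (fun _ => ν) fun _ =>
      measurePreserving_snd (μ := ν) (ν := ν)
  have j1 : Integrable (fun z : Fin m → Ω × Ω => signedSup F e (fun j => (z j).2))
      (Measure.pi fun _ => ν.prod ν) :=
    integrable_of_abs_le ((hHm e).comp hsnd.measurable) fun z => abs_signedSup_le hF.abs_le_one _ _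
  have j2 : Integrable (fun z : Fin m → Ω × Ω => signedSup F (-e) (fun j => (z j).1))
      (Measure.pi fun _ => ν.prod ν) :=
    integrable_of_abs_le ((hHm _).comp hfst.measurable) fun z => abs_signedSup_le hF.abs_le_one _ _
  have i1 : ∫ s, signedSup F e s ∂Measure.pi (fun _ : Fin m => ν)
      = ∫ z : Fin m → Ω × Ω, signedSup F e (fun j => (z j).2) ∂Measure.pi (fun _ => ν.prod ν) := by
    rw [← hsnd.map_eq, integral_map hsnd.measurable.aemeasurable (hHm e).aestronglyMeasurable]
  have i2 : ∫ s, signedSup F (-e) s ∂Measure.pi (fun _ : Fin m => ν)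
      = ∫ z : Fin m → Ω × Ω, signedSup F (-e) (fun j => (z j).1)
          ∂Measure.pi (fun _ => ν.prod ν) := by
    rw [← hfst.map_eq, integral_map hfst.measurable.aemeasurable (hHm _).aestronglyMeasurable]
  rw [i1, i2, ← integral_add j1 j2]
  refine integral_mono (integrable_of_abs_le hWm fun z => abs_signedSup_le hF.abs_pairDiff_le _ _)
    (j1.add j2) fun z => ciSup_le fun θ => ?_
  refine le_trans (le_of_eq ?_) (add_le_add
    (le_signedSup hF.abs_le_one e (fun j => (z j).2) θ)
    (le_signedSup hF.abs_le_one (-e) (fun j => (z j).1) θ))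
  rw [← Finset.sum_add_distrib]
  refine Finset.sum_congr rfl fun j _ => ?_
  simp [pairDiff]
  ring

/-- Symmetrization: the expected deviation is at most twice the Rademacher average. -/
theorem integral_deviation_le (hF : IsUnitLipschitzClass F K) {R : ℝ}
    (hR : ∀ s : Fin m → Ω, 𝔼 e : Fin m → ℤˣ, signedSup F e s ≤ R) :
    ∫ s, deviation ν F s ∂Measure.pi (fun _ : Fin m => ν) ≤ 2 * R := by
  have hHi : ∀ e, Integrable (signedSup F e) (Measure.pi fun _ : Fin m => ν) := fun e =>
    integrable_of_abs_le (measurable_signedSup hF.nonneg_const hF.abs_le_one hF.le_add_mul_dist e)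
      (abs_signedSup_le hF.abs_le_one e)
  have havg : 𝔼 e : Fin m → ℤˣ, ∫ s, signedSup F e s ∂Measure.pi (fun _ : Fin m => ν) ≤ R := by
    have : 𝔼 e : Fin m → ℤˣ, ∫ s, signedSup F e s ∂Measure.pi (fun _ : Fin m => ν)
        = ∫ s, (𝔼 e : Fin m → ℤˣ, signedSup F e s) ∂Measure.pi (fun _ : Fin m => ν) := by
      simp_rw [Fintype.expect_eq_sum_div_card]
      rw [integral_div, integral_finsetSum _ fun e _ => hHi e]
    rw [this]
    refine (integral_mono (g := fun _ => R) ?_ (integrable_const R) fun s => hR s).trans ?_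
    · simp_rw [Fintype.expect_eq_sum_div_card]
      exact (integrable_finsetSum _ fun e _ => hHi e).div_const _
    · simp
  refine (hF.integral_deviation_le_integral_signedSup ν).trans ?_
  rw [← Fintype.expect_const (ι := Fin m → ℤˣ) (∫ z, signedSup (pairDiff F) 1 z ∂_),
    Finset.expect_congr rfl fun e _ => hF.integral_signedSup_pairDiff ν e]
  refine (Finset.expect_le_expect fun e _ => hF.integral_signedSup_pairDiff_le ν e).trans ?_
  rw [Finset.expect_add_distrib,
    Fintype.expect_equiv (Equiv.neg _)
      (fun e : Fin m → ℤˣ => ∫ s, signedSup F (-e) s ∂Measure.pi (fun _ : Fin m => ν))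
      (fun e => ∫ s, signedSup F e s ∂Measure.pi (fun _ : Fin m => ν)) fun e => by simp]
  linarith

end Nonempty

/-- Uniform deviation bound in terms of the Rademacher averages of the class. -/
theorem exists_measurableSet_deviation_le (hF : IsUnitLipschitzClass F K) (hm : 1 ≤ m) {R τ : ℝ}
    (hτ : 0 ≤ τ)
    (hR : Nonempty Θ → ∀ s : Fin m → Ω, 𝔼 e : Fin m → ℤˣ, signedSup F e s ≤ m * R) :
    ∃ B : Set (Fin m → Ω), MeasurableSet B ∧
      (Measure.pi fun _ : Fin m => ν).real B ≤ Real.exp (-(2 * m * τ ^ 2)) ∧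
      ∀ s ∉ B, ∀ θ, ∫ u, F θ u ∂ν ≤ 1 / m * ∑ j, F θ (s j) + 2 * R + τ := by
  -- A Gram cell may contain no dictionary, so the empty class has to be allowed.
  rcases isEmpty_or_nonempty Θ with hΘ | hΘ
  · exact ⟨∅, MeasurableSet.empty, by simp [Real.exp_nonneg], fun s _ θ => hΘ.elim θ⟩
  have hm0 : (0 : ℝ) < m := by exact_mod_cast hm
  -- Values in `[0, 1]` make the unnormalized deviation move by at most 1 when one sample changes.
  -- McDiarmid at level `m * τ` with `c = 1` gives the exponent `-2 m τ²`.
  have hd1 : ∀ (s : Fin m → Ω) j ω,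
      deviation ν F (Function.update s j ω) ≤ deviation ν F s + 1 := by
    intro s j ω
    refine ciSup_le fun θ => ?_
    have := hF.le_deviation ν s θ
    have h2 : ∑ i, -F θ (Function.update s j ω i) ≤ ∑ i, -F θ (s i) + 1 := by
      rw [← Finset.add_sum_erase _ _ (Finset.mem_univ j),
        ← Finset.add_sum_erase (a := j) _ (fun i => -F θ (s i)) (Finset.mem_univ j),
        Finset.sum_congr rfl fun i hi => by
          rw [Function.update_of_ne (Finset.ne_of_mem_erase hi)]]
      simp only [Function.update_self]
      linarith [hF.nonneg θ ω, hF.le_one θ (s j)]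
    linarith
  have hd : ∀ (s : Fin m → Ω) j ω,
      |deviation ν F (Function.update s j ω) - deviation ν F s| ≤ 1 := by
    intro s j ω
    have h2 := hd1 (Function.update s j ω) j (s j)
    rw [Function.update_idem, Function.update_eq_self] at h2
    exact abs_le.2 ⟨by linarith, by linarith [hd1 s j ω]⟩
  have htail := measureReal_integral_add_le_le_exp ν (hF.measurable_deviation ν)
    (hF.abs_deviation_le ν) zero_le_one hd (mul_nonneg hm0.le hτ)
  refine ⟨_, measurableSet_le measurable_const (hF.measurable_deviation ν),
    htail.trans (le_of_eq ?_), fun s hs θ => ?_⟩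
  · congr 1
    field_simp
  · have h2 := hF.integral_deviation_le ν (hR hΘ)
    have h3 := hF.le_deviation ν s θ
    simp only [Set.mem_ofPred_eq, not_le] at hs
    have h4 : m * (∫ u, F θ u ∂ν) ≤ ∑ j, F θ (s j) + m * (2 * R + τ) := by
      simp only [Finset.sum_neg_distrib] at h3
      linarith
    rw [← mul_le_mul_iff_right₀ hm0]
    refine h4.trans (le_of_eq ?_)
    field_simp
    ring

end IsUnitLipschitzClass

end DictLearn

namespace DictLearn

/-! ### Sparse representations in dictionaries with small Babel function -/

theorem babel_nonneg {n p : ℕ} (k : ℕ) (D : Dictionary n p) : 0 ≤ babel k D := by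
  refine Real.sSup_nonneg ?_
  rintro _ ⟨Λ, i, -, -, rfl⟩
  exact Finset.sum_nonneg fun l _ => abs_nonneg _

/-- `babel` uses sets of exactly `k` indices. A smaller `S` is padded inside the complement of `i`,
which has at least `k` elements because `k < p`. -/
theorem sum_abs_inner_le_babel {n p k : ℕ} (D : Dictionary n p) {S : Finset (Fin p)} {i : Fin p}
    (hk : k < p) (hS : S.card ≤ k) (hi : i ∉ S) :
    ∑ l ∈ S, |inner ℝ (D l) (D i)| ≤ babel k D := by
  obtain ⟨Λ, h1, h2, h3⟩ := Finset.exists_subsuperset_card_eq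
    (s := S) (t := Finset.univ.erase i) (fun l hl => by
      simp only [Finset.mem_erase, Finset.mem_univ, and_true]
      rintro rfl
      exact hi hl) hS (by simp; omega)
  refine (Finset.sum_le_sum_of_subset_of_nonneg h1 fun l _ _ => abs_nonneg _).trans ?_
  refine le_csSup ?_ ⟨Λ, i, h3, fun h => by simpa using h2 h, rfl⟩
  refine (Set.Finite.subset (Set.finite_range fun q : Finset (Fin p) × Fin p =>
    ∑ l ∈ q.1, |inner ℝ (D l) (D q.2)|) ?_).bddAbove
  rintro _ ⟨Λ, i, -, -, rfl⟩
  exact ⟨(Λ, i), rfl⟩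

theorem norm_synth_sq {n p : ℕ} (D : Dictionary n p) (a : Fin p → ℝ) :
    ‖synth D a‖ ^ 2 = ∑ i, ∑ l, a i * a l * inner ℝ (D i) (D l) := by
  rw [← real_inner_self_eq_norm_sq, synth, sum_inner]
  refine Finset.sum_congr rfl fun i _ => ?_
  rw [inner_sum]
  refine Finset.sum_congr rfl fun l _ => ?_
  rw [real_inner_smul_left, real_inner_smul_right]
  ring

/-- A lower bound for the sparse singular values, by Gershgorin's argument. -/
theorem one_sub_mul_sum_sq_le {n p k : ℕ} (hk : 1 ≤ k) (hkp : k ≤ p) {δ : ℝ}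
    {D : Dictionary n p} (hD : ∀ i, ‖D i‖ = 1) (hδ : babel (k - 1) D ≤ δ)
    {a : Fin p → ℝ} (ha : a ∈ sparseSet p k) :
    (1 - δ) * ∑ i, a i ^ 2 ≤ ‖synth D a‖ ^ 2 := by
  classical
  -- The off-diagonal absolute Gram entries on the support of `a`. A row has at most `k - 1` of
  -- them, hence the Babel function at `k - 1`.
  let w : Fin p → Fin p → ℝ := fun i l =>
    if l ≠ i ∧ a i ≠ 0 ∧ a l ≠ 0 then |inner ℝ (D l) (D i)| else 0
  have hsymm : ∀ i l, w i l = w l i := fun i l => by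
    simp only [w]
    rw [real_inner_comm]
    exact if_congr ⟨fun h => ⟨h.1.symm, h.2.2, h.2.1⟩, fun h => ⟨h.1.symm, h.2.2, h.2.1⟩⟩ rfl rfl
  have hrow : ∀ i, a i ^ 2 * ∑ l, w i l ≤ a i ^ 2 * δ := by
    intro i
    by_cases hi : a i = 0
    · simp [hi]
    refine mul_le_mul_of_nonneg_left (le_trans (le_of_eq ?_) ((sum_abs_inner_le_babel D (k := k - 1)
      (S := (Finset.univ.filter fun l => a l ≠ 0).erase i) (i := i) (by omega) ?_
        (by simp)).trans hδ)) (sq_nonneg _)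
    · rw [← Finset.sum_filter]
      congr 1
      ext l
      simp [hi]
    · rw [Finset.card_erase_of_mem (by simp [hi])]
      exact Nat.sub_le_sub_right ha 1
  -- `|a i * a l| ≤ (a i ^ 2 + a l ^ 2) / 2` splits each off-diagonal term; by the symmetry of `w`
  -- both halves sum to the same weighted row sums.
  have hpt : ∀ i l, (if i = l then a i ^ 2 else 0) - (a i ^ 2 / 2 * w i l + a l ^ 2 / 2 * w i l)
      ≤ a i * a l * inner ℝ (D i) (D l) := by
    intro i l
    by_cases hil : i = l
    · subst hil
      simp only [w, ne_eq, not_true_eq_false, false_and, if_false, if_true, mul_zero, add_zero,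
        sub_zero, real_inner_self_eq_norm_sq, hD]
      nlinarith
    by_cases h : a i ≠ 0 ∧ a l ≠ 0
    · simp only [w, hil, if_false, ne_eq, Ne.symm hil, not_false_eq_true, h.1, h.2,
        and_self, if_true]
      rw [real_inner_comm]
      have h1 := neg_abs_le (a i * a l * inner ℝ (D i) (D l))
      rw [abs_mul] at h1
      have h2 : |a i * a l| ≤ a i ^ 2 / 2 + a l ^ 2 / 2 :=
        abs_le.2 ⟨by nlinarith [sq_nonneg (a i + a l)], by nlinarith [sq_nonneg (a i - a l)]⟩
      have h3 := mul_le_mul_of_nonneg_right h2 (abs_nonneg (inner ℝ (D i) (D l) : ℝ))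
      linarith
    · have h0 : a i * a l = 0 := by
        rcases not_and_or.1 h with h | h <;> simp [not_not.1 h]
      have hw : w i l = 0 := if_neg fun h' => h h'.2
      simp [h0, hw, hil]
  have hsum : ∑ i, ∑ l, a l ^ 2 / 2 * w i l = ∑ i, ∑ l, a i ^ 2 / 2 * w i l := by
    rw [Finset.sum_comm]
    exact Finset.sum_congr rfl fun i _ => Finset.sum_congr rfl fun l _ => by rw [hsymm]
  have hhalf : ∑ i, ∑ l, a i ^ 2 / 2 * w i l = (∑ i, a i ^ 2 * ∑ l, w i l) / 2 := by
    rw [Finset.sum_div]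
    refine Finset.sum_congr rfl fun i _ => ?_
    rw [← Finset.mul_sum]
    ring
  rw [norm_synth_sq]
  refine le_trans ?_ (Finset.sum_le_sum fun i _ => Finset.sum_le_sum fun l _ => hpt i l)
  simp only [Finset.sum_sub_distrib, Finset.sum_add_distrib, Finset.sum_ite_eq, Finset.mem_univ,
    if_true]
  rw [hsum, hhalf]
  have := Finset.sum_le_sum fun i (_ : i ∈ Finset.univ) => hrow i
  rw [← Finset.sum_mul] at this
  linarith

/-! ### The representation error and its minimizers -/

theorem repError_nonneg {n p : ℕ} (A : Set (Fin p → ℝ)) (D : Dictionary n p)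
    (x : EuclideanSpace ℝ (Fin n)) : 0 ≤ repError A D x :=
  Real.iInf_nonneg fun _ => norm_nonneg _

theorem repError_le {n p : ℕ} {A : Set (Fin p → ℝ)} (D : Dictionary n p)
    (x : EuclideanSpace ℝ (Fin n)) {a : Fin p → ℝ} (ha : a ∈ A) :
    repError A D x ≤ ‖synth D a - x‖ :=
  ciInf_le ⟨0, by rintro _ ⟨b, rfl⟩; exact norm_nonneg _⟩ (⟨a, ha⟩ : A)

theorem synth_smul {n p : ℕ} (D : Dictionary n p) (c : ℝ) (a : Fin p → ℝ) :
    synth D (c • a) = c • synth D a := by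
  simp [synth, Finset.smul_sum, mul_smul]

theorem zero_mem_sparseSet (p k : ℕ) : (0 : Fin p → ℝ) ∈ sparseSet p k := by
  simp [sparseSet]

theorem smul_mem_sparseSet {p k : ℕ} (c : ℝ) {a : Fin p → ℝ} (ha : a ∈ sparseSet p k) :
    c • a ∈ sparseSet p k := by
  refine le_trans (Finset.card_le_card fun i hi => ?_) ha
  simp only [Finset.mem_filter, Finset.mem_univ, true_and, Pi.smul_apply] at hi ⊢
  exact fun h => hi (by simp [h])

theorem repError_sparseSet_le_norm {n p k : ℕ} (D : Dictionary n p)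
    (x : EuclideanSpace ℝ (Fin n)) : repError (sparseSet p k) D x ≤ ‖x‖ := by
  simpa [synth] using repError_le D x (zero_mem_sparseSet p k)

theorem repError_sparseSet_le_add {n p k : ℕ} (D : Dictionary n p)
    (x y : EuclideanSpace ℝ (Fin n)) :
    repError (sparseSet p k) D x ≤ repError (sparseSet p k) D y + dist x y := by
  obtain ⟨a, ha, h⟩ := exists_repError_sparseSet_eq k D y
  refine (repError_le D x ha).trans ?_
  rw [← h, ← dist_eq_norm, ← dist_eq_norm, dist_comm x y]
  exact dist_triangle _ _ _

/-- The best sparse approximation of a unit vector has coefficients that are bounded in terms of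
the Babel function. -/
theorem exists_repError_eq_and_sum_sq_le {n p k : ℕ} (hk : 1 ≤ k) (hkp : k ≤ p) {δ : ℝ}
    {D : Dictionary n p} (hD : ∀ i, ‖D i‖ = 1) (hδ : babel (k - 1) D ≤ δ)
    {u : EuclideanSpace ℝ (Fin n)} (hu : ‖u‖ = 1) :
    ∃ a ∈ sparseSet p k, ‖synth D a - u‖ = repError (sparseSet p k) D u ∧
      (1 - δ) * ∑ i, a i ^ 2 ≤ 1 := by
  obtain ⟨a, ha, h⟩ := exists_repError_sparseSet_eq k D u
  refine ⟨a, ha, h, (one_sub_mul_sum_sq_le hk hkp hD hδ ha).trans ?_⟩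
  set w := synth D a with hw
  rcases (norm_nonneg w).eq_or_lt with h0 | hpos
  · rw [← h0]
    norm_num
  have hexp : ∀ c : ℝ, ‖c • w - u‖ ^ 2 = c ^ 2 * ‖w‖ ^ 2 - 2 * (c * inner ℝ w u) + 1 := by
    intro c
    rw [norm_sub_sq_real, norm_smul, mul_pow, real_inner_smul_left, hu, Real.norm_eq_abs, sq_abs]
    norm_num
  -- `sparseSet` is closed under scaling, so the minimizer is at least as good as its best multiple,
  -- the projection of `u` on the line of `w`. This forces `‖w‖² = ⟨w, u⟩ ≤ ‖w‖`.
  have hmin : ∀ c : ℝ, ‖w - u‖ ^ 2 ≤ ‖c • w - u‖ ^ 2 := by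
    intro c
    refine pow_le_pow_left₀ (norm_nonneg _) ?_ 2
    rw [h, hw, ← synth_smul]
    exact repError_le D u (smul_mem_sparseSet c ha)
  have h1 := hmin (inner ℝ w u / ‖w‖ ^ 2)
  have h2 := hexp 1
  rw [one_smul] at h2
  rw [h2, hexp] at h1
  have h3 : (inner ℝ w u / ‖w‖ ^ 2) ^ 2 * ‖w‖ ^ 2 - 2 * (inner ℝ w u / ‖w‖ ^ 2 * inner ℝ w u) + 1
      = 1 - (inner ℝ w u) ^ 2 / ‖w‖ ^ 2 := by
    field_simp
    ring
  rw [h3] at h1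
  have h4 : (inner ℝ w u) ^ 2 / ‖w‖ ^ 2 * ‖w‖ ^ 2 = (inner ℝ w u) ^ 2 := by field_simp
  have h5 : (‖w‖ ^ 2 - inner ℝ w u) ^ 2 ≤ 0 := by
    have := mul_le_mul_of_nonneg_right h1 (sq_nonneg ‖w‖)
    nlinarith
  have h6 : ‖w‖ ^ 2 = inner ℝ w u := by
    have := pow_eq_zero_iff (two_ne_zero) |>.1 (le_antisymm h5 (sq_nonneg _))
    linarith
  have h7 : (inner ℝ w u : ℝ) ≤ ‖w‖ := by simpa [hu] using real_inner_le_norm w u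
  have h8 : ‖w‖ ≤ 1 := by nlinarith
  exact pow_le_one₀ (norm_nonneg _) h8

/-- Cauchy–Schwarz on the support, which has at most `k` elements. -/
theorem sum_abs_sq_le_of_mem_sparseSet {p k : ℕ} {a : Fin p → ℝ} (ha : a ∈ sparseSet p k) :
    (∑ i, |a i|) ^ 2 ≤ k * ∑ i, a i ^ 2 := by
  classical
  have h1 : ∑ i, |a i| = ∑ i ∈ Finset.univ.filter (fun i => a i ≠ 0), |a i| := by
    rw [Finset.sum_filter]
    exact Finset.sum_congr rfl fun i _ => by by_cases h : a i = 0 <;> simp [h]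
  rw [h1]
  refine sq_sum_le_card_mul_sum_sq.trans ?_
  simp only [sq_abs]
  refine mul_le_mul (by exact_mod_cast ha)
    (Finset.sum_le_sum_of_subset_of_nonneg (Finset.subset_univ _) fun i _ _ => sq_nonneg _)
    (Finset.sum_nonneg fun i _ => sq_nonneg _) (Nat.cast_nonneg k)

/-- The squared representation error depends Lipschitz continuously on the inner products of the
vector with the dictionary and on the Gram matrix. -/
theorem repError_sq_sub_le {n p k : ℕ} (hk : 1 ≤ k) (hkp : k ≤ p) {δ ε : ℝ} (hδ1 : δ < 1)
    (D : Dictionary n p) {D' : Dictionary n p} (hD' : ∀ i, ‖D' i‖ = 1)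
    (hδ : babel (k - 1) D' ≤ δ)
    (hε : ∀ i l, |(inner ℝ (D i) (D l) : ℝ) - inner ℝ (D' i) (D' l)| ≤ ε)
    {u : EuclideanSpace ℝ (Fin n)} (hu : ‖u‖ = 1) :
    repError (sparseSet p k) D u ^ 2 - repError (sparseSet p k) D' u ^ 2
      ≤ 2 / √(1 - δ) * √(∑ i, ((inner ℝ (D i) u : ℝ) - inner ℝ (D' i) u) ^ 2)
        + k / (1 - δ) * ε := by
  have hδ0 : 0 < 1 - δ := by linarith
  obtain ⟨a, ha, h, hsq⟩ := exists_repError_eq_and_sum_sq_le hk hkp hD' hδ hu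
  have hsq' : ∑ i, a i ^ 2 ≤ 1 / (1 - δ) := by rw [le_div_iff₀ hδ0]; linarith
  have hε0 : 0 ≤ ε := (abs_nonneg _).trans (hε ⟨0, by omega⟩ ⟨0, by omega⟩)
  -- `a` is optimal for `D'` and a mere competitor for `D`, so only `D'` needs the Babel bound. The
  -- quadratic parts differ by at most `‖a‖₁² ε`, the linear parts by Cauchy–Schwarz.
  have hexp : ∀ D : Dictionary n p, ‖synth D a - u‖ ^ 2
      = ∑ i, ∑ l, a i * a l * inner ℝ (D i) (D l) - 2 * ∑ i, a i * inner ℝ (D i) u + 1 := by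
    intro D
    have : (inner ℝ (synth D a) u : ℝ) = ∑ i, a i * inner ℝ (D i) u := by
      rw [synth, sum_inner]
      exact Finset.sum_congr rfl fun i _ => real_inner_smul_left _ _ _
    rw [norm_sub_sq_real, norm_synth_sq, hu, this]
    norm_num
  have h1 : repError (sparseSet p k) D u ^ 2 ≤ ‖synth D a - u‖ ^ 2 :=
    pow_le_pow_left₀ (repError_nonneg _ _ _) (repError_le D u ha) 2
  rw [← h]
  rw [hexp] at h1 ⊢
  have hG : ∑ i, ∑ l, a i * a l * inner ℝ (D i) (D l)
      - ∑ i, ∑ l, a i * a l * inner ℝ (D' i) (D' l) ≤ k / (1 - δ) * ε := by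
    calc _ = ∑ i, ∑ l, a i * a l * ((inner ℝ (D i) (D l) : ℝ) - inner ℝ (D' i) (D' l)) := by
          simp only [mul_sub, Finset.sum_sub_distrib]
      _ ≤ ∑ i, ∑ l, |a i| * |a l| * ε := by
          refine Finset.sum_le_sum fun i _ => Finset.sum_le_sum fun l _ => ?_
          refine (le_abs_self _).trans ?_
          rw [abs_mul, abs_mul]
          exact mul_le_mul_of_nonneg_left (hε i l) (by positivity)
      _ = (∑ i, |a i|) ^ 2 * ε := by
          rw [sq, Finset.sum_mul_sum, Finset.sum_mul]
          simp only [Finset.sum_mul]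
      _ ≤ k / (1 - δ) * ε := by
          refine mul_le_mul_of_nonneg_right ((sum_abs_sq_le_of_mem_sparseSet ha).trans ?_) hε0
          rw [div_eq_mul_one_div]
          exact mul_le_mul_of_nonneg_left hsq' (Nat.cast_nonneg k)
  have hv : ∑ i, a i * inner ℝ (D' i) u - ∑ i, a i * inner ℝ (D i) u
      ≤ 1 / √(1 - δ) * √(∑ i, ((inner ℝ (D i) u : ℝ) - inner ℝ (D' i) u) ^ 2) := by
    calc _ = ∑ i, -a i * ((inner ℝ (D i) u : ℝ) - inner ℝ (D' i) u) := by
          rw [← Finset.sum_sub_distrib]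
          exact Finset.sum_congr rfl fun i _ => by ring
      _ ≤ √(∑ i, (-a i) ^ 2) * √(∑ i, ((inner ℝ (D i) u : ℝ) - inner ℝ (D' i) u) ^ 2) :=
          Real.sum_mul_le_sqrt_mul_sqrt _ _ _
      _ ≤ _ := by
          refine mul_le_mul_of_nonneg_right ?_ (Real.sqrt_nonneg _)
          simp only [neg_sq]
          refine (Real.sqrt_le_sqrt hsq').trans (le_of_eq ?_)
          rw [Real.sqrt_div zero_le_one, Real.sqrt_one]
  have e : 2 / √(1 - δ) = 2 * (1 / √(1 - δ)) := by ring
  rw [e]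
  linarith

/-! ### Rademacher averages of the squared error -/

/-- The error is 1-Lipschitz in `u`, and at most 1 on the sphere because `0` is sparse; squaring
doubles the Lipschitz constant. -/
theorem isUnitLipschitzClass_repError_sq {n p k : ℕ} {Θ : Type*} (D : Θ → Dictionary n p) :
    IsUnitLipschitzClass
      (fun θ (u : Sphere n) => repError (sparseSet p k) (D θ) (u : EuclideanSpace ℝ (Fin n)) ^ 2)
      2 := by
  have h1 : ∀ θ (u : Sphere n), repError (sparseSet p k) (D θ) u ≤ 1 := fun θ u =>
    (repError_sparseSet_le_norm _ _).trans (by simp)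
  refine ⟨by norm_num, fun θ u => sq_nonneg _, fun θ u =>
    pow_le_one₀ (repError_nonneg _ _ _) (h1 θ u), fun θ u v => ?_⟩
  have h2 := repError_sparseSet_le_add (k := k) (D θ) (u : EuclideanSpace ℝ (Fin n)) v
  have h3 := repError_nonneg (sparseSet p k) (D θ) u
  have h4 := repError_nonneg (sparseSet p k) (D θ) v
  have h5 := h1 θ u
  have h6 := h1 θ v
  have h7 : (0 : ℝ) ≤ dist u v := dist_nonneg
  rw [← Subtype.dist_eq] at h2
  nlinarith

/-- The Rademacher average of the linear functionals given by unit dictionaries. -/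
theorem expect_iSup_sum_signSum_inner_le {n p m : ℕ} {Θ : Type*} [Nonempty Θ]
    {D : Θ → Dictionary n p} (hD : ∀ θ i, ‖D θ i‖ = 1) {L : ℝ} (hL : 0 ≤ L) (s : Fin m → Sphere n) :
    𝔼 t : Fin m → Fin p → ℤˣ, (⨆ θ, L * ∑ j, signSum (t j)
      (fun i => inner ℝ (D θ i) (s j : EuclideanSpace ℝ (Fin n)))) ≤ L * (p * √m) := by
  have hsup : ∀ t : Fin m → Fin p → ℤˣ, (⨆ θ, L * ∑ j, signSum (t j)
      (fun i => inner ℝ (D θ i) (s j : EuclideanSpace ℝ (Fin n))))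
      ≤ L * ∑ i, ‖∑ j, ((t j i : ℤ) : ℝ) • (s j : EuclideanSpace ℝ (Fin n))‖ := by
    refine fun t => ciSup_le fun θ => mul_le_mul_of_nonneg_left ?_ hL
    simp only [signSum]
    rw [Finset.sum_comm]
    refine Finset.sum_le_sum fun i _ => ?_
    have : ∑ j, ((t j i : ℤ) : ℝ) * inner ℝ (D θ i) (s j : EuclideanSpace ℝ (Fin n))
        = inner ℝ (D θ i) (∑ j, ((t j i : ℤ) : ℝ) • (s j : EuclideanSpace ℝ (Fin n))) := by
      rw [inner_sum]
      exact Finset.sum_congr rfl fun j _ => (real_inner_smul_right _ _ _).symm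
    rw [this]
    simpa [hD] using real_inner_le_norm (D θ i)
      (∑ j, ((t j i : ℤ) : ℝ) • (s j : EuclideanSpace ℝ (Fin n)))
  have hone : ∀ i : Fin p, 𝔼 t : Fin m → Fin p → ℤˣ,
      ‖∑ j, ((t j i : ℤ) : ℝ) • (s j : EuclideanSpace ℝ (Fin n))‖ ≤ √m := by
    intro i
    have h2 := expect_norm_add_sum_sign_smul_sq i 0 fun j => (s j : EuclideanSpace ℝ (Fin n))
    simp only [zero_add, norm_zero, norm_eq_of_mem_sphere] at h2
    have hm : (0 : ℝ) ≤ m := Nat.cast_nonneg m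
    -- This inequality plays the role of Jensen: the mean square of the norm is `m`, so its mean is
    -- at most `√m`.
    have hpt : ∀ y : ℝ, 2 * √m * y ≤ y ^ 2 + m := fun y => by
      nlinarith [sq_nonneg (y - √m), Real.sq_sqrt hm]
    have h3 := Finset.expect_le_expect (s := Finset.univ) fun (t : Fin m → Fin p → ℤˣ) _ =>
      hpt ‖∑ j, ((t j i : ℤ) : ℝ) • (s j : EuclideanSpace ℝ (Fin n))‖
    rw [← Finset.mul_expect, Finset.expect_add_distrib, Fintype.expect_const, h2] at h3
    rcases Nat.eq_zero_or_pos m with rfl | hm1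
    · simp
    have hs : 0 < √(m : ℝ) := Real.sqrt_pos.2 (by exact_mod_cast hm1)
    have h4 := Real.sq_sqrt hm
    norm_num at h3
    nlinarith
  refine (Finset.expect_le_expect fun t _ => hsup t).trans ?_
  rw [← Finset.mul_expect, Finset.expect_sum_comm]
  refine mul_le_mul_of_nonneg_left ((Finset.sum_le_sum fun i _ => hone i).trans ?_) hL
  simp

theorem expect_signedSup_repError_sq_le {n p k m : ℕ} (hk : 1 ≤ k) (hkp : k ≤ p) {δ ε : ℝ}
    (hδ1 : δ < 1) {Θ : Type*} [Nonempty Θ] {D : Θ → Dictionary n p} (hD : ∀ θ i, ‖D θ i‖ = 1)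
    (hδ : ∀ θ, babel (k - 1) (D θ) ≤ δ)
    (hε : ∀ θ θ' i l, |(inner ℝ (D θ i) (D θ l) : ℝ) - inner ℝ (D θ' i) (D θ' l)| ≤ ε)
    (s : Fin m → Sphere n) :
    𝔼 e : Fin m → ℤˣ, signedSup
      (fun θ (u : Sphere n) => repError (sparseSet p k) (D θ) (u : EuclideanSpace ℝ (Fin n)) ^ 2) e s
      ≤ 2 * (2 / √(1 - δ)) * (p * √m) + m * (k / (1 - δ) * ε / 2) := by
  have hcl := isUnitLipschitzClass_repError_sq (k := k) D
  have h := expect_iSup_add_signSum_le (Θ := Θ) (fun _ => 0)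
    (fun j θ => repError (sparseSet p k) (D θ) (s j : EuclideanSpace ℝ (Fin n)) ^ 2)
    (fun j θ i => inner ℝ (D θ i) (s j : EuclideanSpace ℝ (Fin n)))
    (2 / √(1 - δ)) (k / (1 - δ) * ε) 1 (by positivity) ⟨0, by rintro _ ⟨θ, rfl⟩; rfl⟩
    (fun j θ => hcl.abs_le_one θ (s j))
    (fun j θ i => by
      simpa [hD] using abs_real_inner_le_norm (D θ i) (s j : EuclideanSpace ℝ (Fin n)))
    (fun j θ θ' => repError_sq_sub_le hk hkp hδ1 (D θ) (hD θ') (hδ θ') (hε θ θ') (by simp))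
  simp only [zero_add] at h
  refine h.trans (add_le_add ?_ le_rfl)
  exact expect_iSup_sum_signSum_inner_le hD (by positivity) s

end DictLearn

namespace DictLearn

/-! ### Discretization of the Gram matrix -/

/-- The interval `[-1, 1]` splits into `r` pieces of length `2 / r`. -/
theorem exists_cell_of_Icc (r : ℕ) (hr : 1 ≤ r) :
    ∃ q : ℝ → Fin r, ∀ x y : ℝ, |x| ≤ 1 → |y| ≤ 1 → q x = q y → |x - y| ≤ 2 / r := by
  have hr0 : (0 : ℝ) < r := by exact_mod_cast hr
  -- The minimum with `r - 1` puts the endpoint `x = 1` into the last cell.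
  refine ⟨fun x => ⟨min ⌊r * (x + 1) / 2⌋₊ (r - 1), by omega⟩, fun x y hx hy h => ?_⟩
  have key : ∀ x : ℝ, |x| ≤ 1 →
      ((min ⌊r * (x + 1) / 2⌋₊ (r - 1) : ℕ) : ℝ) ≤ r * (x + 1) / 2 ∧
      r * (x + 1) / 2 ≤ ((min ⌊r * (x + 1) / 2⌋₊ (r - 1) : ℕ) : ℝ) + 1 := by
    intro x hx
    have h0 : 0 ≤ r * (x + 1) / 2 := by
      have := neg_le_of_abs_le hx
      have : 0 ≤ x + 1 := by linarith
      positivity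
    refine ⟨le_trans (by exact_mod_cast min_le_left _ _) (Nat.floor_le h0), ?_⟩
    rcases min_choice ⌊r * (x + 1) / 2⌋₊ (r - 1) with h | h <;> rw [h]
    · exact (Nat.lt_floor_add_one _).le
    · rw [Nat.cast_sub hr]
      have := le_of_abs_le hx
      push_cast
      nlinarith
  have hx' := key x hx
  have hy' := key y hy
  rw [Fin.mk.injEq] at h
  rw [h] at hx'
  rw [le_div_iff₀ hr0, ← Nat.abs_cast, ← abs_mul]
  exact abs_le.2 ⟨by linarith [hx'.1, hy'.2], by linarith [hx'.2, hy'.1]⟩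

/-- With `lam = k / (1 - δ)`, the choice of `r` gives `3 √m lam ≤ r ≤ 4 √m lam`. The lower bound
makes the rounding term `2 lam / r` at most `2 lam p / √m`, which with the Rademacher term `8 lam p
/ √m` stays below `14 lam p / √m`. The upper bound gives `log r ≤ log (16 m lam²) / 2`. -/
theorem two_mul_add_sqrt_le {p m : ℕ} {k δ x : ℝ} (hp : 1 ≤ p) (hm : 1 ≤ m) (hk : 1 ≤ k)
    (hδ0 : 0 ≤ δ) (hδ1 : δ < 1) (hx : 0 ≤ x) {r : ℕ} (hr : r = ⌊4 * √m * (k / (1 - δ))⌋₊) :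
    1 ≤ r ∧ 2 * ((2 * (2 / √(1 - δ)) * (p * √m) + m * (k / (1 - δ) * (2 / r) / 2)) / m)
      + √((x + p * p * Real.log r) / (2 * m))
      ≤ p / √m * (14 * k / (1 - δ) + 1 / 2 * √(Real.log (16 * m * (k / (1 - δ)) ^ 2)))
        + √(x / (2 * m)) := by
  have hm1 : (1 : ℝ) ≤ m := by exact_mod_cast hm
  have hp1 : (1 : ℝ) ≤ p := by exact_mod_cast hp
  have hδp : 0 < 1 - δ := by linarith
  set w := √(m : ℝ) with hw
  have hw1 : 1 ≤ w := Real.one_le_sqrt.2 hm1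
  have hww : (m : ℝ) = w ^ 2 := (Real.sq_sqrt (by linarith)).symm
  rw [mul_div_assoc 14]
  set lam := k / (1 - δ) with hlam
  have hinv1 : 1 ≤ 1 / (1 - δ) := by rw [le_div_iff₀ hδp]; linarith
  have hinvlam : 1 / (1 - δ) ≤ lam := by rw [hlam]; gcongr
  have hlam1 : 1 ≤ lam := hinv1.trans hinvlam
  have hwl : 1 ≤ w * lam := one_le_mul_of_one_le_of_one_le hw1 hlam1
  have hfl : (r : ℝ) ≤ 4 * w * lam := hr ▸ Nat.floor_le (by positivity)
  have hr3 : 3 * (w * lam) ≤ r := by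
    have := Nat.lt_floor_add_one (4 * w * lam)
    rw [← hr] at this
    nlinarith
  have hr1 : (1 : ℝ) ≤ r := by linarith
  have hr0 : (0 : ℝ) < r := by linarith
  refine ⟨by exact_mod_cast hr1, ?_⟩
  have hsq : 1 / √(1 - δ) ≤ 1 / (1 - δ) := by
    refine one_div_le_one_div_of_le hδp ?_
    exact Real.le_sqrt_of_sq_le (by nlinarith)
  have hR : 2 * ((2 * (2 / √(1 - δ)) * (p * w) + m * (lam * (2 / r) / 2)) / m)
      ≤ p / w * (14 * lam) := by
    have e1 : 2 * ((2 * (2 / √(1 - δ)) * (p * w) + m * (lam * (2 / r) / 2)) / m)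
        = p / w * (8 * (1 / √(1 - δ))) + 2 * (lam / r) := by
      rw [hww]
      field_simp
      ring
    have e2 : lam / r ≤ p / w * lam := by
      rw [div_mul_eq_mul_div, div_le_div_iff₀ hr0 (by linarith)]
      nlinarith [mul_le_mul hp1 hr3 (by positivity) (by linarith)]
    have e3 : p / w * (8 * (1 / √(1 - δ))) ≤ p / w * (8 * lam) := by
      gcongr
      exact hsq.trans hinvlam
    have e4 : 0 ≤ p / w * lam := by positivity
    rw [e1]
    linarith
  have hlog : Real.log r ≤ Real.log (16 * m * lam ^ 2) / 2 := by
    have : 16 * m * lam ^ 2 = (4 * w * lam) ^ 2 := by rw [hww]; ring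
    rw [this, Real.log_pow]
    have := Real.log_le_log hr0 hfl
    push_cast
    linarith
  have hτ : √((x + p * p * Real.log r) / (2 * m))
      ≤ √(x / (2 * m)) + p / w * (1 / 2 * √(Real.log (16 * m * lam ^ 2))) := by
    have hlog0 : 0 ≤ Real.log (16 * m * lam ^ 2) := by
      linarith [Real.log_nonneg hr1]
    rw [add_div]
    have hlogr := Real.log_nonneg hr1
    have hsub : ∀ a b : ℝ, 0 ≤ a → 0 ≤ b → √(a + b) ≤ √a + √b := fun a b ha hb =>
      Real.sqrt_le_iff.2 ⟨by positivity, by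
        nlinarith [Real.sq_sqrt ha, Real.sq_sqrt hb, Real.sqrt_nonneg a, Real.sqrt_nonneg b]⟩
    refine (hsub _ _ (by positivity) (by positivity)).trans (add_le_add le_rfl ?_)
    refine Real.sqrt_le_iff.2 ⟨by positivity, ?_⟩
    rw [mul_pow, mul_pow, Real.sq_sqrt hlog0, div_pow, ← hww, div_le_iff₀ (by positivity)]
    have : (p : ℝ) * p * Real.log r ≤ p * p * (Real.log (16 * m * lam ^ 2) / 2) := by gcongr
    refine this.trans (le_of_eq ?_)
    field_simp
  rw [mul_add]
  linarith

end DictLearn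

/-! ### Union bound over the Gram cells -/

theorem theorem8 (n p k m : ℕ) (hk : 1 ≤ k) (hkp : k ≤ p) (hm : 1 ≤ m)
    (δ x : ℝ) (hδ : δ < 1) (hx : 0 ≤ x)
    (ν : MeasureTheory.Measure (DictLearn.Sphere n)) [MeasureTheory.IsProbabilityMeasure ν] :
    ∃ G : Set (Fin m → DictLearn.Sphere n), MeasurableSet G ∧
      ENNReal.ofReal (1 - Real.exp (-x)) ≤ MeasureTheory.Measure.pi (fun _ : Fin m => ν) G ∧
      ∀ s ∈ G, ∀ D : DictLearn.Dictionary n p, (∀ i, ‖D i‖ = 1) →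
        DictLearn.babel (k - 1) D ≤ δ →
        (∫ u, DictLearn.repError (DictLearn.sparseSet p k) D u ^ 2 ∂ν) ≤
          (1 / (m : ℝ)) * ∑ j, DictLearn.repError (DictLearn.sparseSet p k) D (s j) ^ 2
          + ((p : ℝ) / √(m : ℝ)) *
            (14 * k / (1 - δ) + (1 / 2) * √(Real.log (16 * m * (k / (1 - δ)) ^ 2)))
          + √(x / (2 * m)) := by
  classical
  -- For `δ < 0` no dictionary qualifies, since the Babel function is nonnegative. The estimate of
  -- the constants needs `0 ≤ δ`, which gives `k / (1 - δ) ≥ 1`.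
  rcases lt_or_ge δ 0 with hneg | hδ0
  · refine ⟨Set.univ, MeasurableSet.univ, ?_, fun s _ D _ hb => ?_⟩
    · rw [measure_univ]
      exact ENNReal.ofReal_le_one.2 (by linarith [Real.exp_nonneg (-x)])
    · exact absurd ((DictLearn.babel_nonneg _ D).trans hb) (not_le.2 hneg)
  obtain ⟨r, hr⟩ : ∃ r : ℕ, r = ⌊4 * √m * (k / (1 - δ))⌋₊ := ⟨_, rfl⟩
  obtain ⟨hr1, hbound⟩ := DictLearn.two_mul_add_sqrt_le (p := p) (k := k) (x := x)
    (hk.trans hkp) hm (by exact_mod_cast hk) hδ0 hδ hx hr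
  have hm0 : (0 : ℝ) < m := by exact_mod_cast hm
  have hr0 : (0 : ℝ) < r := by exact_mod_cast hr1
  have hlog0 : 0 ≤ Real.log r := Real.log_nonneg (by exact_mod_cast hr1)
  obtain ⟨q, hq⟩ := DictLearn.exists_cell_of_Icc r hr1
  -- Chosen so that `exp (-2 m τ²) = exp (-x) / r ^ (p * p)`: the failure probabilities of all cells
  -- add up to `exp (-x)`.
  set τ := √((x + p * p * Real.log r) / (2 * m)) with hτ
  set R := (2 * (2 / √(1 - δ)) * (p * √m) + m * (k / (1 - δ) * (2 / r) / 2)) / m with hR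
  have hinner : ∀ D : DictLearn.Dictionary n p, (∀ i, ‖D i‖ = 1) → ∀ i l,
      |(inner ℝ (D i) (D l) : ℝ)| ≤ 1 := fun D hD i l => by
    simpa [hD] using abs_real_inner_le_norm (D i) (D l)
  -- Two dictionaries of one cell have Gram entries within `2 / r` of each other, so they are
  -- compared directly and no cell needs a center.
  have hcell : ∀ c : Fin p → Fin p → Fin r, ∃ B : Set (Fin m → DictLearn.Sphere n),
      MeasurableSet B ∧ (Measure.pi fun _ : Fin m => ν).real B ≤ Real.exp (-(2 * m * τ ^ 2)) ∧
      ∀ s ∉ B, ∀ D : {D : DictLearn.Dictionary n p // (∀ i, ‖D i‖ = 1) ∧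
        DictLearn.babel (k - 1) D ≤ δ ∧ ∀ i l, q (inner ℝ (D i) (D l)) = c i l},
        ∫ u : DictLearn.Sphere n, DictLearn.repError (DictLearn.sparseSet p k) D.1 u ^ 2 ∂ν
        ≤ 1 / m * ∑ j, DictLearn.repError (DictLearn.sparseSet p k) D.1 (s j) ^ 2 + 2 * R + τ := by
    intro c
    refine (DictLearn.isUnitLipschitzClass_repError_sq fun D : {D : DictLearn.Dictionary n p //
      (∀ i, ‖D i‖ = 1) ∧ DictLearn.babel (k - 1) D ≤ δ ∧
        ∀ i l, q (inner ℝ (D i) (D l)) = c i l} => D.1).exists_measurableSet_deviation_le ν hm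
      (Real.sqrt_nonneg _) fun _ s => ?_
    rw [hR, mul_div_cancel₀ _ hm0.ne']
    exact DictLearn.expect_signedSup_repError_sq_le hk hkp hδ (fun D => D.2.1)
      (fun D => D.2.2.1) (fun D D' i l => hq _ _ (hinner _ D.2.1 i l) (hinner _ D'.2.1 i l)
        (by rw [D.2.2.2, D'.2.2.2])) s
  choose B hBm hBν hB using hcell
  have hBU : (Measure.pi fun _ : Fin m => ν).real (⋃ c, B c) ≤ Real.exp (-x) := by
    refine (measureReal_iUnion_fintype_le _).trans
      ((Finset.sum_le_sum fun c _ => hBν c).trans (le_of_eq ?_))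
    have hexp : Real.exp (-(2 * m * τ ^ 2)) = Real.exp (-x) / r ^ (p * p) := by
      rw [hτ, Real.sq_sqrt (by positivity), ← Real.exp_log (pow_pos hr0 (p * p)),
        ← Real.exp_sub, Real.log_pow]
      congr 1
      push_cast
      field_simp
      ring
    rw [hexp]
    simp only [Finset.sum_const, Finset.card_univ, Fintype.card_fun, Fintype.card_fin, nsmul_eq_mul]
    push_cast
    rw [← pow_mul]
    field_simp
  refine ⟨(⋃ c, B c)ᶜ, (MeasurableSet.iUnion hBm).compl, ?_, fun s hs D hD hb => ?_⟩
  · rw [← ofReal_measureReal, probReal_compl_eq_one_sub (MeasurableSet.iUnion hBm)]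
    exact ENNReal.ofReal_le_ofReal (by linarith)
  · have hsB : s ∉ B (fun i l => q (inner ℝ (D i) (D l))) := fun h =>
      hs (Set.mem_iUnion.2 ⟨_, h⟩)
    have := hB _ s hsB ⟨D, hD, hb, fun _ _ => rfl⟩
    simp only at this
    linarith
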